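/- Let $N$ run through the positive integers. For each $N$ let $W^{(N)}$ be a uniformly distributed random $N\times N$ signed permutation matrix (a matrix with entries $\epsilon_i\delta_{i,\sigma(j)}$, $\epsilon_i\in\{\pm1\}$, $\sigma\in S_N$), defined on an arbitrary probability space depending on $N$, and let $H^{(N)}$ be a deterministic $N\times N$ complex Hadamard matrix (i.e. $|H^{(N)}(i,j)|=1$ for all $i,j$ and $H^{(N)}/\sqrt N$ is unitary). Put $$U^{(N)}=\tfrac1{\sqrt N}\,W^{(N)*}H^{(N)}W^{(N)}.$$ Let $A^{(N)},B^{(N)}$ be deterministic $N\times N$ Hermitian matrices whose operator norms (largest singular values) are bounded uniformly in $N$, and let $\mu_A,\mu_B$ be laws of bounded real random variables such that for every integer $k>0$ $$\lim_{N\to\infty}\tfrac1N\operatorname{tr}\bigl((A^{(N)})^k\bigr)=\int x^k\,d\mu_A,\qquad \lim_{N\to\infty}\tfrac1N\operatorname{tr}\bigl((B^{(N)})^k\bigr)=\int x^k\,d\mu_B .$$ Regard $N\times N$ random matrices with essentially bounded entries as noncommutative random variables with respect to the tracial state $\phi^{(N)}(Z)=\frac1N\mathbf E\operatorname{tr}Z$.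 Then: 1. $A^{(N)}$ and $U^{(N)}B^{(N)}U^{(N)*}$ are asymptotically free. That is, for every noncommutative polynomial $f\in\mathbb C\langle X_1,X_2\rangle$ the limit $\tau(f)=\lim_{N\to\infty}\phi^{(N)}\bigl(f(A^{(N)},U^{(N)}B^{(N)}U^{(N)*})\bigr)$ exists, and $X_1,X_2$ are free with respect to $\tau$: one has $\tau(p_1\cdots p_\ell)=0$ whenever $\ell\ge2$, each $p_j$ is a polynomial in the single variable $X_{i_j}$ with $\tau(p_j)=0$, and $i_j\ne i_{j+1}$ for $1\le j<\ell$. 2. The free additive convolution $\mu_A\boxplus\mu_B$ (the compactly supported probability measure on $\mathbb R$ whose moments are those of $a+b$, for free noncommutative random variables $a,b$ with laws $\mu_A,\mu_B$) exists, and the law of $A^{(N)}+U^{(N)}B^{(N)}U^{(N)*}$ converges to it in moments: for every $k\ge0$, $$\lim_{N\to\infty}\phi^{(N)}\Bigl(\bigl(A^{(N)}+U^{(N)}B^{(N)}U^{(N)*}\bigr)^k\Bigr)=\int x^k\,d(\mu_A\boxplus\mu_B).$$ 3. If $A^{(N)}$ is nonnegative definite for every $N$, then the free multiplicative convolution $\mu_A\boxtimes\mu_B$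 (the compactly supported probability measure on $\mathbb R$ whose moments are those of $ab$, for $a,b$ free with laws $\mu_A,\mu_B$) exists, and the law of $(A^{(N)})^{1/2}U^{(N)}B^{(N)}U^{(N)*}(A^{(N)})^{1/2}$ converges to it in moments, in the same sense. -/

import Mathlib

open MeasureTheory ProbabilityTheory Filter Topology
open scoped ENNReal Matrix MatrixOrder ComplexOrder

noncomputable section

/-! Noncommutative probability: laws and freeness with respect to a linear functional. -/

section FreeProbability

variable {I : Type*} {𝒜 : Type*} [Ring 𝒜] [Algebra ℂ 𝒜]

/-- The joint law of a family `a` of noncommutative random variables: the functional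
`f ↦ φ (f (a))` on noncommutative polynomials in variables indexed by `I`. -/
def jointLaw (φ : 𝒜 →ₗ[ℂ] ℂ) (a : I → 𝒜) : FreeAlgebra ℂ I →ₗ[ℂ] ℂ :=
  φ ∘ₗ (FreeAlgebra.lift ℂ a).toLinearMap

/-- Freeness of a family of unital subalgebras: `φ (a₁ ⋯ a_ℓ) = 0` whenever `ℓ ≥ 2`, the `a_j` are
centred, `a_j` lies in the subalgebra of index `i_j`, and consecutive indices are distinct.
The list holds the pairs `(i_j, a_j)`. -/
def FreeSubalgebras (φ : 𝒜 →ₗ[ℂ] ℂ) (S : I → Subalgebra ℂ 𝒜) : Prop :=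
  ∀ l : List (I × 𝒜), 2 ≤ l.length → l.IsChain (fun x y => x.1 ≠ y.1) →
    (∀ x ∈ l, x.2 ∈ S x.1 ∧ φ x.2 = 0) → φ (l.map Prod.snd).prod = 0

/-- A family of elements is free if the unital subalgebras they generate are free. -/
def FreeFamily (φ : 𝒜 →ₗ[ℂ] ℂ) (a : I → 𝒜) : Prop :=
  FreeSubalgebras φ (fun i => Algebra.adjoin ℂ {a i})

end FreeProbability

/-- Asymptotic freeness of a sequence of families in a sequence of noncommutative probability
spaces: the joint laws converge in moments, and the variables are free under the limit law. -/
def AsymptoticallyFree {I : Type*} {𝒜 : ℕ → Type*} [∀ N, Ring (𝒜 N)] [∀ N, Algebra ℂ (𝒜 N)]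
    (φ : ∀ N, 𝒜 N →ₗ[ℂ] ℂ) (a : ∀ N, I → 𝒜 N) : Prop :=
  ∃ τ : FreeAlgebra ℂ I →ₗ[ℂ] ℂ,
    (∀ f, Tendsto (fun N => jointLaw (φ N) (a N) f) atTop (𝓝 (τ f))) ∧
    FreeFamily τ (FreeAlgebra.ι ℂ)

/-- A sequence of noncommutative random variables converges in moments to a measure on `ℝ`. -/
def ConvergesInMoments {𝒜 : ℕ → Type*} [∀ N, Ring (𝒜 N)] [∀ N, Algebra ℂ (𝒜 N)]
    (φ : ∀ N, 𝒜 N →ₗ[ℂ] ℂ) (a : ∀ N, 𝒜 N) (ρ : Measure ℝ) : Prop :=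
  ∀ k : ℕ, Tendsto (fun N => φ N (a N ^ k)) atTop (𝓝 ((∫ x, x ^ k ∂ρ : ℝ) : ℂ))

/-! Free convolution of laws of bounded real random variables. -/

/-- `μ` is the law of a bounded real random variable. -/
structure IsBoundedLaw (μ : Measure ℝ) : Prop where
  isProbabilityMeasure : IsProbabilityMeasure μ
  bounded : ∃ R : ℝ, ∀ᵐ x ∂μ, |x| ≤ R

/-- `τ` is the joint law of a pair of free noncommutative random variables, the first one having
the moments of `μ` and the second one those of `ν`. -/
structure IsFreePairLaw (μ ν : Measure ℝ) (τ : FreeAlgebra ℂ (Fin 2) →ₗ[ℂ] ℂ) : Prop where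
  map_one : τ 1 = 1
  free : FreeFamily τ (FreeAlgebra.ι ℂ)
  left : ∀ k : ℕ, τ (FreeAlgebra.ι ℂ 0 ^ k) = ((∫ x, x ^ k ∂μ : ℝ) : ℂ)
  right : ∀ k : ℕ, τ (FreeAlgebra.ι ℂ 1 ^ k) = ((∫ x, x ^ k ∂ν : ℝ) : ℂ)

/-- `ρ` is a free additive convolution of `μ` and `ν`: a bounded law with the moments of the sum of
two free variables with laws `μ` and `ν`. (There is at most one such `ρ`: freeness determines the
joint law, and a bounded law is determined by its moments.) -/
structure IsFreeAddConv (μ ν ρ : Measure ℝ) : Prop where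
  isBoundedLaw : IsBoundedLaw ρ
  moments : ∃ τ, IsFreePairLaw μ ν τ ∧ ∀ k : ℕ,
    τ ((FreeAlgebra.ι ℂ 0 + FreeAlgebra.ι ℂ 1) ^ k) = ((∫ x, x ^ k ∂ρ : ℝ) : ℂ)

/-- `ρ` is a free multiplicative convolution of `μ` and `ν`: a bounded law with the moments of the
product of two free variables with laws `μ` and `ν`. (There is at most one such `ρ`. It is
used when `μ` lives on `[0, ∞)`, so that the product can be symmetrized without changing its
moments under a trace.) -/
structure IsFreeMulConv (μ ν ρ : Measure ℝ) : Prop where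
  isBoundedLaw : IsBoundedLaw ρ
  moments : ∃ τ, IsFreePairLaw μ ν τ ∧ ∀ k : ℕ,
    τ ((FreeAlgebra.ι ℂ 0 * FreeAlgebra.ι ℂ 1) ^ k) = ((∫ x, x ^ k ∂ρ : ℝ) : ℂ)

open scoped Classical in
/-- The free additive convolution `μ ⊞ ν` (by convention `0` where it does not exist). -/
def freeAddConv (μ ν : Measure ℝ) : Measure ℝ :=
  if h : ∃ ρ, IsFreeAddConv μ ν ρ then h.choose else 0

open scoped Classical in
/-- The free multiplicative convolution `μ ⊠ ν` (by convention `0` where it does not exist). -/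
def freeMulConv (μ ν : Measure ℝ) : Measure ℝ :=
  if h : ∃ ρ, IsFreeMulConv μ ν ρ then h.choose else 0

/-! Signed permutation matrices and complex Hadamard matrices. -/

/-- The set of matrices with entries `W i j = ε i * δ (i, σ j)`, where `ε i = ± 1` and `σ` is a
permutation. -/
def signedPermMatrices (N : ℕ) : Set (Matrix (Fin N) (Fin N) ℂ) :=
  {W | ∃ (ε : Fin N → ℂ) (σ : Equiv.Perm (Fin N)), (∀ i, ε i = 1 ∨ ε i = -1) ∧
    W = Matrix.of fun i j => if i = σ j then ε i else 0}

/-- `H` has unimodular entries, and `H / √N` is unitary. -/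
structure IsComplexHadamard {N : ℕ} (H : Matrix (Fin N) (Fin N) ℂ) : Prop where
  norm_entry : ∀ i j, ‖H i j‖ = 1
  unitary : ((√(N : ℝ) : ℝ) : ℂ)⁻¹ • H ∈ Matrix.unitaryGroup (Fin N) ℂ

/-! The noncommutative probability space of bounded random matrices. -/

instance matrixMeasurableSpace (N : ℕ) : MeasurableSpace (Matrix (Fin N) (Fin N) ℂ) :=
  inferInstanceAs (MeasurableSpace (Fin N → Fin N → ℂ))

section RandomMatrix

variable {Ω : Type*} [MeasurableSpace Ω]

/-- The algebra of `N`-by-`N` random matrices with essentially bounded entries. -/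
def BddRandomMatrix (N : ℕ) (P : Measure Ω) [IsProbabilityMeasure P] :
    StarSubalgebra ℂ (Ω → Matrix (Fin N) (Fin N) ℂ) where
  carrier := {X | ∀ i j, MemLp (fun ω => X ω i j) ∞ P}
  mul_mem' := by
    intro X Y hX hY i j
    have h : (fun ω => (X * Y) ω i j) = fun ω => ∑ k, X ω i k * Y ω k j := by
      funext ω; simp [Matrix.mul_apply]
    rw [h]
    exact memLp_finsetSum _ fun k _ => (hY k j).mul (hX i k)
  add_mem' := fun hX hY i j => (hX i j).add (hY i j)
  algebraMap_mem' := fun r i j => memLp_const _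
  star_mem' := by
    intro X hX i j
    exact (hX j i).star

/-- The tracial state `Z ↦ (1/N) E tr Z`. -/
def matrixState (N : ℕ) (P : Measure Ω) [IsProbabilityMeasure P] :
    BddRandomMatrix N P →ₗ[ℂ] ℂ where
  toFun Z := (N : ℂ)⁻¹ * ∫ ω, (Z.1 ω).trace ∂P
  map_add' := by
    intro X Y
    have hi : ∀ Z : BddRandomMatrix N P, Integrable (fun ω => (Z.1 ω).trace) P := fun Z =>
      integrable_finsetSum _ fun i _ => (Z.2 i i).integrable (by simp)
    have h : ∀ ω, ((X + Y).1 ω).trace = (X.1 ω).trace + (Y.1 ω).trace := fun ω =>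
      Matrix.trace_add _ _
    simp only [h]
    rw [integral_add (hi X) (hi Y), mul_add]
  map_smul' := by
    intro c X
    have h : ∀ ω, ((c • X).1 ω).trace = c * (X.1 ω).trace := fun ω =>
      Matrix.trace_smul c (X.1 ω)
    simp only [h]
    rw [integral_const_mul]
    simp only [RingHom.id_apply, smul_eq_mul]
    ring

/-- A deterministic matrix, regarded as a random matrix. -/
def constMatrix {N : ℕ} (P : Measure Ω) [IsProbabilityMeasure P]
    (M : Matrix (Fin N) (Fin N) ℂ) : BddRandomMatrix N P :=
  ⟨fun _ => M, fun _ _ => memLp_const _⟩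

/-- `W` is a uniformly distributed random signed permutation matrix. -/
def IsUniformSignedPerm {N : ℕ} (P : Measure Ω) (W : Ω → Matrix (Fin N) (Fin N) ℂ) : Prop :=
  HasLaw W (uniformOn (signedPermMatrices N)) P

theorem signedPermMatrices_finite (N : ℕ) : (signedPermMatrices N).Finite := by
  have hf : (Set.univ.pi fun _ : Fin N => ({1, -1} : Set ℂ)).Finite :=
    Set.Finite.pi fun _ => by simp
  refine ((hf.prod (Set.finite_univ (α := Equiv.Perm (Fin N)))).image
    fun p => Matrix.of fun i j => if i = p.2 j then p.1 i else 0).subset ?_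
  rintro W ⟨ε, σ, hε, rfl⟩
  exact ⟨(ε, σ), ⟨fun i _ => hε i, trivial⟩, rfl⟩

theorem IsUniformSignedPerm.mem {N : ℕ} {P : Measure Ω} [IsProbabilityMeasure P]
    {W : Ω → Matrix (Fin N) (Fin N) ℂ} (h : IsUniformSignedPerm P W) : W ∈ BddRandomMatrix N P := by
  have hms : MeasurableSet (signedPermMatrices N) :=
    Set.Finite.measurableSet (α := Fin N → Fin N → ℂ) (signedPermMatrices_finite N)
  have hae : ∀ᵐ w ∂(P.map W), w ∈ signedPermMatrices N := by
    rw [HasLaw.map_eq h]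
    exact ae_cond_mem hms
  have hae' := ae_of_ae_map (HasLaw.aemeasurable h) hae
  intro i j
  have hm : Measurable fun w : Matrix (Fin N) (Fin N) ℂ => w i j :=
    (measurable_pi_apply j).comp (measurable_pi_apply (X := fun _ : Fin N => Fin N → ℂ) i)
  refine memLp_top_of_bound
    (hm.comp_aemeasurable (HasLaw.aemeasurable h)).aestronglyMeasurable 1 ?_
  filter_upwards [hae'] with ω hω
  obtain ⟨ε, σ, hε, hω⟩ := hω
  rw [hω, Matrix.of_apply]
  split_ifs
  · rcases hε i with h | h <;> simp [h]
  · simp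

/-- A uniformly distributed random signed permutation matrix, as an element of the algebra. -/
def IsUniformSignedPerm.toBdd {N : ℕ} {P : Measure Ω} [IsProbabilityMeasure P]
    {W : Ω → Matrix (Fin N) (Fin N) ℂ} (h : IsUniformSignedPerm P W) : BddRandomMatrix N P :=
  ⟨W, h.mem⟩

/-- The fake Haar unitary `N^(-1/2) W* H W`. -/
def fakeHaar {N : ℕ} {P : Measure Ω} [IsProbabilityMeasure P]
    {W : Ω → Matrix (Fin N) (Fin N) ℂ} (hW : IsUniformSignedPerm P W)
    (H : Matrix (Fin N) (Fin N) ℂ) : BddRandomMatrix N P :=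
  ((√(N : ℝ) : ℝ) : ℂ)⁻¹ • (star hW.toBdd * constMatrix P H * hW.toBdd)

end RandomMatrix

end

/-! A Finner inequality with exponents `1/2`. -/

section Finner

/-! Put `K 0 = 1` and `K 1 = H / √N`. For each value `W` of the random matrix, a polynomial in one
of the two variables takes the value `W* K i (W Z W*) K i* W`, with `Z` the same polynomial in `A`
or in `B` (`lift_fakeHaarPair_of_mem_adjoin`). In the trace of an alternating product of `n` centred
polynomials the outer `W` and `W*` cancel, and what remains is the average over `W` of `tr ∏ K i_j
(W Z_j W*) K i_j*`, with deterministic `Z_j` of trace zero and bounded norm.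

Expanding every `W Z_j W*` in matrix units separates the two ingredients. The coefficients are
products of entries of the `K i* K j`; these entries have modulus `N^(-1/2)` for `i ≠ j`, so a
coefficient is at most `N^(-(n-1)/2)` (`norm_trace_prod_single_le`). The averaged entries of the `W
Z_j W*` have absolute values summing to at most `C N^(n/2)` (`exists_sum_norm_conjMoment_le`). With
the factor `1/N` of the state this gives `O(N^(-1/2))`.

For the second estimate, sign changes kill every average in which some index occurs only once, and
permutations make the average depend only on which indices coincide. Sums of absolute values over a
coincidence pattern are therefore absolute values of sums, and these are graph sums in which every
vertex has degree at least two. An isolated loop contributes a trace, which is zero; otherwise every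
vertex meets two edges, and Finner's inequality with exponents `1/2` bounds the sum by a product of
Hilbert-Schmidt norms, each `O(√N)`.

Vanishing of centred alternating moments, together with convergence of the one-variable moments,
gives convergence of the joint law to a free one (`exists_free_limit`). Compactness of the
probability measures on an interval then represents the limiting moments by bounded laws
(`exists_isBoundedLaw_of_tendsto`), which yields both convolutions. -/

theorem sum_prod_rpow_half_le {ι α : Type*} [Fintype α] (E : Finset ι) (hE : 1 < E.card)
    (y : ι → α → ℝ≥0∞) :
    ∑ k, ∏ a ∈ E, (y a k) ^ (1 / 2 : ℝ) ≤ ∏ a ∈ E, (∑ k, y a k) ^ (1 / 2 : ℝ) := by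
  classical
  -- Cauchy-Schwarz for two of the factors; each of the others is at most its total sum.
  obtain ⟨a, ha, b, hb, hab⟩ := Finset.one_lt_card.1 hE
  have hb' : b ∈ E.erase a := Finset.mem_erase.2 ⟨hab.symm, hb⟩
  simp only [← Finset.mul_prod_erase _ _ ha, ← Finset.mul_prod_erase _ _ hb']
  calc ∑ k, y a k ^ (1 / 2 : ℝ) * (y b k ^ (1 / 2 : ℝ) *
        ∏ c ∈ (E.erase a).erase b, y c k ^ (1 / 2 : ℝ))
      ≤ ∑ k, y a k ^ (1 / 2 : ℝ) * (y b k ^ (1 / 2 : ℝ) *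
        ∏ c ∈ (E.erase a).erase b, (∑ k, y c k) ^ (1 / 2 : ℝ)) := by
        gcongr with k _ c _
        exact Finset.single_le_sum (f := fun k => y c k) (fun _ _ => zero_le) (Finset.mem_univ k)
    _ = (∑ k, y a k ^ (1 / 2 : ℝ) * y b k ^ (1 / 2 : ℝ)) *
        ∏ c ∈ (E.erase a).erase b, (∑ k, y c k) ^ (1 / 2 : ℝ) := by
        rw [Finset.sum_mul]; simp only [mul_assoc]
    _ ≤ ((∑ k, y a k) ^ (1 / 2 : ℝ) * (∑ k, y b k) ^ (1 / 2 : ℝ)) *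
        ∏ c ∈ (E.erase a).erase b, (∑ k, y c k) ^ (1 / 2 : ℝ) := by
        gcongr
        have h := ENNReal.inner_le_Lp_mul_Lq Finset.univ (fun k => y a k ^ (1 / 2 : ℝ))
          (fun k => y b k ^ (1 / 2 : ℝ)) (p := 2) (q := 2) Real.HolderConjugate.two_two
        have hsq : ∀ z : ℝ≥0∞, (z ^ (1 / 2 : ℝ)) ^ (2 : ℝ) = z := fun z => by
          rw [← ENNReal.rpow_mul]; simp
        simpa only [hsq] using h
    _ = _ := by rw [mul_assoc]

variable {V ι α : Type*} [Fintype V] [DecidableEq V] [Fintype ι] [Fintype α]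
  [MeasurableSpace α] [MeasurableSingletonClass α]

/-- Sum out one vertex at a time: the factors containing it number at least two and obey
`sum_prod_rpow_half_le`, while the others are constant in its label and come out of the sum. -/
theorem lmarginal_prod_rpow_half_le (T : ι → Finset V) (G : ι → (V → α) → ℝ≥0∞)
    (hG : ∀ a, DependsOn (G a) (T a)) (hT : ∀ v, 1 < (Finset.univ.filter fun a => v ∈ T a).card)
    (S : Finset V) (x : V → α) :
    (∫⋯∫⁻_S, (fun f => ∏ a, G a f ^ (1 / 2 : ℝ)) ∂(fun _ => Measure.count)) x ≤
      ∏ a, ((∫⋯∫⁻_(S ∩ T a), G a ∂(fun _ => Measure.count)) x) ^ (1 / 2 : ℝ) := by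
  classical
  have hm : ∀ F : (V → α) → ℝ≥0∞, Measurable F := fun F => measurable_of_finite F
  induction S using Finset.induction generalizing x with
  | empty => simp
  | insert v S hv ih =>
    rw [lmarginal_insert _ (hm _) hv, lintegral_fintype]
    simp only [Measure.count_singleton, mul_one]
    refine (Finset.sum_le_sum fun k _ => ih (Function.update x v k)).trans ?_
    set Y : ι → α → ℝ≥0∞ := fun a k =>
      (∫⋯∫⁻_(S ∩ T a), G a ∂(fun _ => Measure.count)) (Function.update x v k)
    have h1 : ∀ a, v ∈ T a →
        (∫⋯∫⁻_(insert v S ∩ T a), G a ∂(fun _ => Measure.count)) x = ∑ k, Y a k := by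
      intro a ha
      rw [Finset.insert_inter_of_mem ha, lmarginal_insert _ (hm _) (by simp [hv]),
        lintegral_fintype]
      simp [Y]
    have h2 : ∀ a, v ∉ T a → ∀ k,
        Y a k = (∫⋯∫⁻_(insert v S ∩ T a), G a ∂(fun _ => Measure.count)) x := by
      intro a ha k
      rw [Finset.insert_inter_of_notMem ha]
      simp only [Y]
      rw [lmarginal_update_of_notMem (hm _) (by simp [hv])]
      congr 1
      funext f
      refine hG a fun i hi => ?_
      change Function.update f v k i = f i
      rw [Function.update_of_ne]
      rintro rfl
      exact ha hi
    simp only [← Finset.prod_filter_mul_prod_filter_not Finset.univ (fun a => v ∈ T a)]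
    calc _ = ∑ k, (∏ a with v ∈ T a, Y a k ^ (1 / 2 : ℝ)) * ∏ a with v ∉ T a,
          ((∫⋯∫⁻_(insert v S ∩ T a), G a ∂(fun _ => Measure.count)) x) ^ (1 / 2 : ℝ) := by
          refine Finset.sum_congr rfl fun k _ => ?_
          congr 1
          refine Finset.prod_congr rfl fun a ha => ?_
          rw [← h2 a (Finset.mem_filter.1 ha).2 k]
      _ = (∑ k, ∏ a with v ∈ T a, Y a k ^ (1 / 2 : ℝ)) * _ := by rw [Finset.sum_mul]
      _ ≤ (∏ a with v ∈ T a, (∑ k, Y a k) ^ (1 / 2 : ℝ)) * _ :=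
          mul_le_mul_left (sum_prod_rpow_half_le _ (hT v) Y) _
      _ = _ := by
          congr 1
          refine Finset.prod_congr rfl fun a ha => ?_
          rw [h1 a (Finset.mem_filter.1 ha).2]

theorem sum_prod_edge_le (s t : ι → V) (g : ι → α → α → ℝ≥0∞) (D : ℝ≥0∞)
    (hT : ∀ v, ∃ a b, a ≠ b ∧ (s a = v ∨ t a = v) ∧ (s b = v ∨ t b = v))
    (hg : ∀ a, ∑ u, ∑ v, g a u v ^ 2 ≤ D ^ 2) :
    ∑ f : V → α, ∏ a, g a (f (s a)) (f (t a)) ≤ D ^ Fintype.card ι := by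
  classical
  cases isEmpty_or_nonempty (V → α) with
  | inl h => simp
  | inr h =>
  obtain ⟨x⟩ := h
  set T : ι → Finset V := fun a => {s a, t a}
  set G : ι → (V → α) → ℝ≥0∞ := fun a f => g a (f (s a)) (f (t a)) ^ 2
  have key := lmarginal_prod_rpow_half_le T G
    (fun a f f' hff => by simp only [G]; rw [hff (s a) (by simp [T]), hff (t a) (by simp [T])])
    (fun v => by
      obtain ⟨a, b, hab, ha, hb⟩ := hT v
      refine Finset.one_lt_card.2 ⟨a, ?_, b, ?_, hab⟩
      · simpa [T, eq_comm] using ha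
      · simpa [T, eq_comm] using hb) Finset.univ x
  have hsq : ∀ z : ℝ≥0∞, (z ^ 2) ^ (1 / 2 : ℝ) = z := by
    intro z
    rw [← ENNReal.rpow_natCast, ← ENNReal.rpow_mul]; simp
  rw [lmarginal_univ] at key
  simp only [G, hsq] at key
  have hcount : (Measure.pi fun _ : V => (Measure.count : Measure α)) = Measure.count := by
    refine Measure.ext_of_singleton fun f => ?_
    rw [Measure.pi_singleton]
    simp
  rw [hcount, lintegral_fintype] at key
  simp only [Measure.count_singleton, mul_one] at key
  refine key.trans ((Finset.prod_le_prod' fun a _ => ?_).trans_eq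
    (Finset.prod_const (s := (Finset.univ : Finset ι)) D))
  conv_rhs => rw [← hsq D]
  gcongr
  refine le_trans ?_ (hg a)
  rw [Finset.univ_inter]
  have hm : ∀ F : (V → α) → ℝ≥0∞, Measurable F := fun F => measurable_of_finite F
  by_cases hst : s a = t a
  · simp only [T, hst, Finset.pair_eq_singleton, lmarginal_singleton, lintegral_fintype,
      Measure.count_singleton, mul_one, Function.update_self]
    exact Finset.sum_le_sum fun u _ =>
      Finset.single_le_sum (f := fun v => g a u v ^ 2) (fun _ _ => zero_le) (Finset.mem_univ u)
  · simp only [T]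
    rw [lmarginal_insert _ (hm _) (by simpa using hst)]
    simp [lmarginal_singleton, lintegral_fintype, Function.update_of_ne hst]

end Finner

/-! Sums of products of matrix entries over index functions with prescribed coincidences. -/

section KernelSums

open scoped Classical

variable {ι n : Type*} [Fintype ι]

/-- The product of the entries of the matrices `Z a`, the ends of the edge `a` being labelled by
`i (a, false)` and `i (a, true)`. -/
def edgeProd (Z : ι → Matrix n n ℂ) (i : ι × Bool → n) : ℂ :=
  ∏ a, Z a (i (a, false)) (i (a, true))

theorem sum_le_ker_eq {X M : Type*} [Finite X] [Fintype (X → n)] [AddCommMonoid M] (r : Setoid X)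
    [Fintype (Quotient r → n)] (F : (X → n) → M) :
    ∑ i with r ≤ Setoid.ker i, F i = ∑ f : Quotient r → n, F (fun x => f ⟦x⟧) := by
  refine (Finset.sum_bij (fun f _ => fun x => f ⟦x⟧) ?_ ?_ ?_ ?_).symm
  · intro f _
    simp only [Finset.mem_filter, Finset.mem_univ, true_and]
    intro x y hxy
    exact congrArg f (Quotient.sound hxy)
  · intro f _ g _ h
    funext q
    induction q using Quotient.inductionOn with
    | h x => exact congrFun h x
  · intro i hi
    have hi' := (Finset.mem_filter.1 hi).2
    exact ⟨Quotient.lift i fun _ _ h => hi' h, Finset.mem_univ _, rfl⟩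
  · intro _ _; rfl

variable [Fintype n]

/-- The blocks of `r` are the vertices of a graph with edge set `ι`, and `hr` says that all degrees
are at least two. -/
theorem norm_sum_le_ker_edgeProd_le (r : Setoid (ι × Bool)) (hr : ∀ x, ∃ y, y ≠ x ∧ r x y)
    (Z : ι → Matrix n n ℂ) (hZ : ∀ a, (Z a).trace = 0) (D : ℝ)
    (hD : 0 ≤ D) (hZD : ∀ a, ∑ u, ∑ v, ‖Z a u v‖ ^ 2 ≤ D ^ 2) :
    ‖∑ i with r ≤ Setoid.ker i, edgeProd Z i‖ ≤ D ^ Fintype.card ι := by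
  rw [sum_le_ker_eq]
  by_cases h : ∃ x : ι × Bool, ∀ y, r x y → y.1 = x.1
  -- A block whose points all lie on one edge consists of both ends of that edge, so it is an
  -- isolated loop; summing over its label produces the trace of `Z a'`.
  · obtain ⟨⟨a, b⟩, hx⟩ := h
    obtain ⟨⟨a', b'⟩, hne, hy⟩ := hr (a, b)
    obtain rfl : a' = a := hx _ hy
    have hq : ∀ c, (⟦(a', c)⟧ : Quotient r) = ⟦(a', b)⟧ := by
      intro c
      by_cases hc : c = b
      · rw [hc]
      · have : c = b' := by
          have : b' ≠ b := fun h => hne (by rw [h])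
          cases b <;> cases b' <;> cases c <;> simp_all
        rw [this]
        exact (Quotient.sound hy).symm
    have hq' : ∀ c d, c ≠ a' → (⟦(c, d)⟧ : Quotient r) ≠ ⟦(a', b)⟧ := by
      intro c d hc h
      exact hc (hx _ (Setoid.symm' _ (Quotient.exact h)))
    set q : Quotient r := ⟦(a', b)⟧
    have : ∑ f : Quotient r → n, edgeProd Z (fun x => f ⟦x⟧) = 0 := by
      rw [← (Equiv.funSplitAt q n).symm.sum_comp, Fintype.sum_prod_type_right]
      refine Finset.sum_eq_zero fun g _ => ?_
      have : ∀ k, edgeProd Z (fun x => (Equiv.funSplitAt q n).symm (k, g) ⟦x⟧) =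
          Z a' k k * ∏ c ∈ Finset.univ.erase a',
            if hc : c ≠ a' then Z c (g ⟨⟦(c, false)⟧, hq' _ _ hc⟩) (g ⟨⟦(c, true)⟧, hq' _ _ hc⟩)
            else 0 := by
        intro k
        rw [edgeProd, ← Finset.mul_prod_erase _ _ (Finset.mem_univ a')]
        congr 1
        · simp [hq, Equiv.funSplitAt_symm_apply]
        · refine Finset.prod_congr rfl fun c hc => ?_
          have hc' := (Finset.mem_erase.1 hc).1
          simp [hc', hq' c _ hc', Equiv.funSplitAt_symm_apply]
      simp only [this, ← Finset.sum_mul]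
      have h0 : ∑ k, Z a' k k = 0 := hZ a'
      rw [h0, zero_mul]
    rw [this, norm_zero]
    positivity
  · push Not at h
    let : MeasurableSpace n := ⊤
    have key := sum_prod_edge_le (V := Quotient r) (fun a => ⟦(a, false)⟧) (fun a => ⟦(a, true)⟧)
      (fun a u v => ‖Z a u v‖ₑ) (ENNReal.ofReal D) ?_ ?_
    · refine (norm_sum_le _ _).trans ?_
      rw [← ENNReal.ofReal_le_ofReal_iff (by positivity), ENNReal.ofReal_pow hD,
        ENNReal.ofReal_sum_of_nonneg (fun _ _ => norm_nonneg _)]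
      refine le_trans (le_of_eq ?_) key
      refine Finset.sum_congr rfl fun f _ => ?_
      rw [edgeProd, norm_prod, ENNReal.ofReal_prod_of_nonneg (fun _ _ => norm_nonneg _)]
      simp only [ofReal_norm]
    · intro v
      induction v using Quotient.inductionOn with
      | h x =>
        obtain ⟨y, hxy, hne⟩ := h x
        have hcov : ∀ z : ι × Bool, r x z →
            (⟦(z.1, false)⟧ : Quotient r) = ⟦x⟧ ∨ (⟦(z.1, true)⟧ : Quotient r) = ⟦x⟧ := by
          rintro ⟨c, d⟩ hz
          have := Quotient.sound (Setoid.symm' _ hz)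
          cases d
          · exact Or.inl this
          · exact Or.inr this
        exact ⟨x.1, y.1, hne.symm, hcov x (Setoid.refl' _ _), hcov y hxy⟩
    · intro a
      have := ENNReal.ofReal_le_ofReal (hZD a)
      rw [ENNReal.ofReal_pow hD] at this
      refine le_trans (le_of_eq ?_) this
      rw [ENNReal.ofReal_sum_of_nonneg (fun _ _ => by positivity)]
      refine Finset.sum_congr rfl fun u _ => ?_
      rw [ENNReal.ofReal_sum_of_nonneg (fun _ _ => by positivity)]
      refine Finset.sum_congr rfl fun v _ => ?_
      rw [ENNReal.ofReal_pow (norm_nonneg _), ofReal_norm]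

/-- Möbius inversion on partitions as an induction from coarse to fine: the sum over `r ≤ ker i`
differs from the sum over `ker i = r` by the strictly coarser patterns, which again have no
singleton block. -/
theorem exists_norm_sum_ker_eq_edgeProd_le (r : Setoid (ι × Bool))
    (hr : ∀ x, ∃ y, y ≠ x ∧ r x y) :
    ∃ C : ℝ, 0 ≤ C ∧ ∀ (N : ℕ) (Z : ι → Matrix (Fin N) (Fin N) ℂ) (D : ℝ),
      (∀ a, (Z a).trace = 0) → 0 ≤ D → (∀ a, ∑ u, ∑ v, ‖Z a u v‖ ^ 2 ≤ D ^ 2) →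
      ‖∑ i with Setoid.ker i = r, edgeProd Z i‖ ≤ C * D ^ Fintype.card ι := by
  have : Finite (Setoid (ι × Bool)) :=
    Finite.of_injective (fun s : Setoid (ι × Bool) => s.r) fun s t h =>
      Setoid.ext fun a b => iff_of_eq (congrFun (congrFun h a) b)
  have := Fintype.ofFinite (Setoid (ι × Bool))
  induction r using WellFoundedGT.induction with
  | ind r ih =>
    -- The value `0` outside `r < s` lets `choose` produce constants indexed by all partitions.
    have ih' : ∀ s : Setoid (ι × Bool), ∃ C : ℝ, 0 ≤ C ∧ (r < s →
        ∀ (N : ℕ) (Z : ι → Matrix (Fin N) (Fin N) ℂ) (D : ℝ),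
        (∀ a, (Z a).trace = 0) → 0 ≤ D → (∀ a, ∑ u, ∑ v, ‖Z a u v‖ ^ 2 ≤ D ^ 2) →
        ‖∑ i with Setoid.ker i = s, edgeProd Z i‖ ≤ C * D ^ Fintype.card ι) := by
      intro s
      by_cases hs : r < s
      · obtain ⟨C, hC, h⟩ := ih s hs fun x => by
          obtain ⟨y, hy, hxy⟩ := hr x
          exact ⟨y, hy, hs.le hxy⟩
        exact ⟨C, hC, fun _ => h⟩
      · exact ⟨0, le_rfl, fun h => absurd h hs⟩
    choose C hC h using ih'
    refine ⟨1 + ∑ s with r < s, C s, by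
      have := Finset.sum_nonneg (s := Finset.univ.filter (r < ·)) fun s _ => hC s
      positivity, fun N Z D hZ hD hZD => ?_⟩
    have hsplit : ∑ i with r ≤ Setoid.ker i, edgeProd Z i =
        ∑ i with Setoid.ker i = r, edgeProd Z i +
          ∑ s with r < s, ∑ i with Setoid.ker i = s, edgeProd Z i := by
      have : ∑ i with r ≤ Setoid.ker i, edgeProd Z i =
          ∑ s with r ≤ s, ∑ i with Setoid.ker i = s, edgeProd Z i := by
        rw [← Finset.sum_fiberwise_of_maps_to (t := Finset.univ.filter (r ≤ ·))
          (g := fun i => Setoid.ker i) (fun i hi => by simpa using hi)]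
        refine Finset.sum_congr rfl fun s hs => Finset.sum_congr ?_ fun _ _ => rfl
        ext i
        simp only [Finset.mem_filter, Finset.mem_univ, true_and] at hs ⊢
        exact ⟨fun h => h.2, fun h => ⟨h ▸ hs, h⟩⟩
      rw [this, ← Finset.add_sum_erase _ _ (show r ∈ Finset.univ.filter (r ≤ ·) by simp)]
      congr 1
      refine Finset.sum_congr ?_ fun _ _ => rfl
      ext s
      simp [lt_iff_le_and_ne, and_comm, eq_comm]
    rw [eq_sub_of_add_eq hsplit.symm, add_mul, one_mul, Finset.sum_mul]
    refine (norm_sub_le _ _).trans (add_le_add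
      (norm_sum_le_ker_edgeProd_le r hr Z hZ D hD hZD)
      ((norm_sum_le _ _).trans (Finset.sum_le_sum fun s hs =>
        h s (Finset.mem_filter.1 hs).2 N Z D hZ hD hZD)))

end KernelSums

/-! The group of signed permutation matrices. -/

section SignedPerm

variable {N : ℕ}

/-- The signed permutation matrix with entries `ε i * δ (i, σ j)`. -/
noncomputable def signedPermMatrix (ε : Fin N → ℂ) (σ : Equiv.Perm (Fin N)) :
    Matrix (Fin N) (Fin N) ℂ :=
  Matrix.of fun i j => if i = σ j then ε i else 0

theorem mem_signedPermMatrices {W : Matrix (Fin N) (Fin N) ℂ} :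
    W ∈ signedPermMatrices N ↔ ∃ (ε : Fin N → ℂ) (σ : Equiv.Perm (Fin N)),
      (∀ i, ε i = 1 ∨ ε i = -1) ∧ W = signedPermMatrix ε σ := Iff.rfl

theorem signedPermMatrix_mul_apply (ε : Fin N → ℂ) (σ : Equiv.Perm (Fin N))
    (M : Matrix (Fin N) (Fin N) ℂ) (i j : Fin N) :
    (signedPermMatrix ε σ * M) i j = ε i * M (σ.symm i) j := by
  rw [Matrix.mul_apply, Finset.sum_eq_single (σ.symm i)]
  · simp [signedPermMatrix]
  · intro k _ hk
    have : i ≠ σ k := fun h => hk (by simp [h])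
    simp [signedPermMatrix, this]
  · simp

theorem signedPermMatrix_conj_apply (ε : Fin N → ℂ) (σ : Equiv.Perm (Fin N))
    (M : Matrix (Fin N) (Fin N) ℂ) (i j : Fin N) :
    (signedPermMatrix ε σ * M * star (signedPermMatrix ε σ)) i j =
      ε i * star (ε j) * M (σ.symm i) (σ.symm j) := by
  have : signedPermMatrix ε σ * M * star (signedPermMatrix ε σ) =
      star (signedPermMatrix ε σ * star (signedPermMatrix ε σ * M)) := by simp [mul_assoc]
  rw [this, Matrix.star_apply, signedPermMatrix_mul_apply, star_mul', Matrix.star_apply,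
    signedPermMatrix_mul_apply, star_star]
  ring

theorem signedPermMatrices_mul_mem {Q W : Matrix (Fin N) (Fin N) ℂ}
    (hQ : Q ∈ signedPermMatrices N) (hW : W ∈ signedPermMatrices N) :
    Q * W ∈ signedPermMatrices N := by
  obtain ⟨ε, σ, hε, rfl⟩ := mem_signedPermMatrices.1 hQ
  obtain ⟨ε', σ', hε', rfl⟩ := mem_signedPermMatrices.1 hW
  refine mem_signedPermMatrices.2 ⟨fun i => ε i * ε' (σ.symm i), σ * σ', fun i => ?_, ?_⟩
  · rcases hε i with h | h <;> rcases hε' (σ.symm i) with h' | h' <;> simp [h, h']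
  · ext i j
    rw [signedPermMatrix_mul_apply]
    simp only [signedPermMatrix, Matrix.of_apply, Equiv.symm_apply_eq, Equiv.Perm.mul_apply,
      mul_ite, mul_zero]
    exact if_congr Iff.rfl rfl rfl

theorem signedPermMatrices_mul_star_self {W : Matrix (Fin N) (Fin N) ℂ}
    (hW : W ∈ signedPermMatrices N) : W * star W = 1 := by
  obtain ⟨ε, σ, hε, rfl⟩ := mem_signedPermMatrices.1 hW
  ext i j
  rw [signedPermMatrix_mul_apply, Matrix.star_apply, Matrix.one_apply]
  rcases hε i with h | h <;> by_cases hij : i = j <;>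
    simp [signedPermMatrix, h, hij, eq_comm] <;> simp_all

theorem signedPermMatrices_star_mul_self {W : Matrix (Fin N) (Fin N) ℂ}
    (hW : W ∈ signedPermMatrices N) : star W * W = 1 :=
  mul_eq_one_comm.1 (signedPermMatrices_mul_star_self hW)

theorem signedPermMatrices_star_mem {W : Matrix (Fin N) (Fin N) ℂ}
    (hW : W ∈ signedPermMatrices N) : star W ∈ signedPermMatrices N := by
  obtain ⟨ε, σ, hε, rfl⟩ := mem_signedPermMatrices.1 hW
  refine mem_signedPermMatrices.2 ⟨fun i => ε (σ i), σ.symm, fun i => hε _, ?_⟩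
  ext i j
  rw [Matrix.star_apply]
  by_cases h : j = σ i
  · subst h
    rcases hε (σ i) with h | h <;> simp [signedPermMatrix, h]
  · have : i ≠ σ.symm j := fun h' => h (by simp [h'])
    simp [signedPermMatrix, h, this]

variable (N) in
/-- The finite set of signed permutation matrices. -/
noncomputable def signedPermFinset : Finset (Matrix (Fin N) (Fin N) ℂ) :=
  (signedPermMatrices_finite N).toFinset

theorem mem_signedPermFinset {W : Matrix (Fin N) (Fin N) ℂ} :
    W ∈ signedPermFinset N ↔ W ∈ signedPermMatrices N := by
  simp [signedPermFinset]

theorem one_mem_signedPermFinset : (1 : Matrix (Fin N) (Fin N) ℂ) ∈ signedPermFinset N := by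
  refine mem_signedPermFinset.2 ⟨fun _ => 1, 1, fun _ => Or.inl rfl, ?_⟩
  ext i j
  rw [Matrix.one_apply]
  exact if_congr Iff.rfl rfl rfl

theorem card_signedPermFinset_ne_zero : ((signedPermFinset N).card : ℂ) ≠ 0 :=
  Nat.cast_ne_zero.2 (Finset.card_ne_zero_of_mem one_mem_signedPermFinset)

theorem sum_signedPermFinset_mul_left {M : Type*} [AddCommMonoid M]
    {Q : Matrix (Fin N) (Fin N) ℂ} (hQ : Q ∈ signedPermMatrices N)
    (F : Matrix (Fin N) (Fin N) ℂ → M) :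
    ∑ W ∈ signedPermFinset N, F (Q * W) = ∑ W ∈ signedPermFinset N, F W := by
  refine Finset.sum_bij' (fun W _ => Q * W) (fun W _ => star Q * W) ?_ ?_ ?_ ?_ ?_
  · exact fun W hW => mem_signedPermFinset.2
      (signedPermMatrices_mul_mem hQ (mem_signedPermFinset.1 hW))
  · exact fun W hW => mem_signedPermFinset.2
      (signedPermMatrices_mul_mem (signedPermMatrices_star_mem hQ) (mem_signedPermFinset.1 hW))
  · intro W _
    rw [← mul_assoc, signedPermMatrices_star_mul_self hQ, one_mul]
  · intro W _
    rw [← mul_assoc, signedPermMatrices_mul_star_self hQ, one_mul]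
  · exact fun _ _ => rfl

theorem sum_norm_sq_conj {W : Matrix (Fin N) (Fin N) ℂ} (hW : W ∈ signedPermMatrices N)
    (M : Matrix (Fin N) (Fin N) ℂ) :
    ∑ u, ∑ v, ‖(W * M * star W) u v‖ ^ 2 = ∑ u, ∑ v, ‖M u v‖ ^ 2 := by
  obtain ⟨ε, σ, hε, rfl⟩ := mem_signedPermMatrices.1 hW
  have hn : ∀ i, ‖ε i‖ = 1 := fun i => by rcases hε i with h | h <;> simp [h]
  simp only [signedPermMatrix_conj_apply, norm_mul, norm_star, hn, one_mul]
  rw [← σ.symm.sum_comp fun u => ∑ v, ‖M u v‖ ^ 2]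
  exact Finset.sum_congr rfl fun u _ => σ.symm.sum_comp fun v => ‖M (σ.symm u) v‖ ^ 2

end SignedPerm

/-! ### Averages of products of entries of `W Z W*`. -/

section ConjMoments

open scoped Classical

variable {ι : Type*} [Fintype ι] {N : ℕ}

/-- The sum over signed permutation matrices `W` of the products of entries of `W Z W*`. -/
noncomputable def conjMoment (Z : ι → Matrix (Fin N) (Fin N) ℂ) (i : ι × Bool → Fin N) : ℂ :=
  ∑ W ∈ signedPermFinset N, edgeProd (fun a => W * Z a * star W) i

/-- Invariance of the sum over the group under left translation of `W` by a signed permutation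
matrix. -/
theorem conjMoment_eq (Z : ι → Matrix (Fin N) (Fin N) ℂ) (i : ι × Bool → Fin N)
    (ε : Fin N → ℂ) (σ : Equiv.Perm (Fin N)) (hε : ∀ i, ε i = 1 ∨ ε i = -1) :
    conjMoment Z i = (∏ x, ε (i x)) * conjMoment Z (fun x => σ.symm (i x)) := by
  rw [conjMoment, ← sum_signedPermFinset_mul_left (Q := signedPermMatrix ε σ) ⟨ε, σ, hε, rfl⟩,
    conjMoment, Finset.mul_sum]
  refine Finset.sum_congr rfl fun W _ => ?_
  have hs : ∀ i, star (ε i) = ε i := fun i => by rcases hε i with h | h <;> simp [h]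
  have : ∀ a, signedPermMatrix ε σ * W * Z a * star (signedPermMatrix ε σ * W) =
      signedPermMatrix ε σ * (W * Z a * star W) * star (signedPermMatrix ε σ) := by
    intro a
    simp only [star_mul, mul_assoc]
  simp only [edgeProd, this, signedPermMatrix_conj_apply, hs, Finset.prod_mul_distrib]
  rw [Fintype.prod_prod_type]
  simp [Finset.prod_mul_distrib, mul_comm]

theorem conjMoment_eq_zero (Z : ι → Matrix (Fin N) (Fin N) ℂ) (i : ι × Bool → Fin N)
    (x : ι × Bool) (hx : ∀ y, y ≠ x → i y ≠ i x) : conjMoment Z i = 0 := by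
  -- Flipping the sign of the one coordinate `i x`, which occurs once, turns the moment into its
  -- negative.
  have h := conjMoment_eq Z i (fun k => if k = i x then -1 else 1) 1
    (fun k => by by_cases h : k = i x <;> simp [h])
  rw [Finset.prod_eq_single x (fun y _ hy => by simp [hx y hy]) (by simp)] at h
  simp only [if_true, neg_mul, one_mul] at h
  exact self_eq_neg.1 h

theorem conjMoment_congr (Z : ι → Matrix (Fin N) (Fin N) ℂ) {i i' : ι × Bool → Fin N}
    (h : Setoid.ker i = Setoid.ker i') : conjMoment Z i = conjMoment Z i' := by
  -- Equal kernels give a bijection between the ranges matching the two labellings; it extends to a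
  -- permutation of `Fin N`.
  let e : {k // k ∈ Set.range i} ≃ {k // k ∈ Set.range i'} :=
    ((Setoid.quotientKerEquivRange i).symm.trans
      (Quotient.congrRight fun a b => by rw [h])).trans (Setoid.quotientKerEquivRange i')
  have he : ∀ x, e.extendSubtype (i x) = i' x := by
    intro x
    rw [Equiv.extendSubtype_apply_of_mem _ _ ⟨x, rfl⟩]
    have : (Setoid.quotientKerEquivRange i).symm ⟨i x, x, rfl⟩ = Quotient.mk _ x :=
      (Equiv.symm_apply_eq _).2 rfl
    simp only [e, Equiv.trans_apply, this]
    rfl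
  rw [conjMoment_eq Z i (fun _ => 1) e.extendSubtype.symm fun _ => Or.inl rfl]
  simp [he]

variable (ι) in
theorem exists_sum_norm_conjMoment_le :
    ∃ C : ℝ, 0 ≤ C ∧ ∀ (N : ℕ) (Z : ι → Matrix (Fin N) (Fin N) ℂ) (D : ℝ),
      (∀ a, (Z a).trace = 0) → 0 ≤ D → (∀ a, ∑ u, ∑ v, ‖Z a u v‖ ^ 2 ≤ D ^ 2) →
      ∑ i, ‖conjMoment Z i‖ ≤ (signedPermFinset N).card * (C * D ^ Fintype.card ι) := by
  have : Finite (Setoid (ι × Bool)) :=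
    Finite.of_injective (fun s : Setoid (ι × Bool) => s.r) fun s t h =>
      Setoid.ext fun a b => iff_of_eq (congrFun (congrFun h a) b)
  have := Fintype.ofFinite (Setoid (ι × Bool))
  have hC' : ∀ r : Setoid (ι × Bool), ∃ C : ℝ, 0 ≤ C ∧ ((∀ x, ∃ y, y ≠ x ∧ r x y) →
      ∀ (N : ℕ) (Z : ι → Matrix (Fin N) (Fin N) ℂ) (D : ℝ),
      (∀ a, (Z a).trace = 0) → 0 ≤ D → (∀ a, ∑ u, ∑ v, ‖Z a u v‖ ^ 2 ≤ D ^ 2) →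
      ‖∑ i with Setoid.ker i = r, edgeProd Z i‖ ≤ C * D ^ Fintype.card ι) := by
    intro r
    by_cases hr : ∀ x, ∃ y, y ≠ x ∧ r x y
    · obtain ⟨C, hC, h⟩ := exists_norm_sum_ker_eq_edgeProd_le r hr
      exact ⟨C, hC, fun _ => h⟩
    · exact ⟨0, le_rfl, fun h => absurd h hr⟩
  choose C hC h using hC'
  refine ⟨∑ r, C r, Finset.sum_nonneg fun r _ => hC r, fun N Z D hZ hD hZD => ?_⟩
  rw [← Finset.sum_fiberwise (s := Finset.univ) (g := fun i => Setoid.ker i), Finset.sum_mul,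
    Finset.mul_sum]
  refine Finset.sum_le_sum fun r _ => ?_
  by_cases hr : ∀ x, ∃ y, y ≠ x ∧ r x y
  -- The moment is constant on the class, so norm and sum commute. The sums over `i` and `W` can
  -- then be exchanged, and `W Z W*` has the trace and Hilbert-Schmidt norm of `Z`.
  · have heq : ∑ i with Setoid.ker i = r, ‖conjMoment Z i‖ =
        ‖∑ i with Setoid.ker i = r, conjMoment Z i‖ := by
      rcases (Finset.univ.filter fun i : ι × Bool → Fin N => Setoid.ker i = r).eq_empty_or_nonempty
        with h0 | ⟨i₀, hi₀⟩
      · simp [h0]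
      · have hc : ∀ i ∈ Finset.univ.filter fun i : ι × Bool → Fin N => Setoid.ker i = r,
            conjMoment Z i = conjMoment Z i₀ := fun i hi =>
          conjMoment_congr Z ((Finset.mem_filter.1 hi).2.trans (Finset.mem_filter.1 hi₀).2.symm)
        rw [Finset.sum_congr rfl hc, Finset.sum_congr rfl fun i hi => by rw [hc i hi]]
        simp
    rw [heq]
    simp only [conjMoment]
    rw [Finset.sum_comm]
    refine (norm_sum_le _ _).trans ?_
    rw [← nsmul_eq_mul]
    refine Finset.sum_le_card_nsmul _ _ _ fun W hW => ?_
    have hW' := mem_signedPermFinset.1 hW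
    refine h r hr N _ D (fun a => ?_) hD fun a => ?_
    · rw [Matrix.trace_mul_comm, ← mul_assoc, signedPermMatrices_star_mul_self hW', one_mul, hZ]
    · rw [sum_norm_sq_conj hW']
      exact hZD a
  · have h0 : ∑ i with Setoid.ker i = r, ‖conjMoment Z i‖ = 0 := by
      push Not at hr
      obtain ⟨x, hx⟩ := hr
      refine Finset.sum_eq_zero fun i hi => ?_
      rw [conjMoment_eq_zero Z i x fun y hy hxy => hx y hy ?_, norm_zero]
      rw [← (Finset.mem_filter.1 hi).2]
      exact hxy.symm
    rw [h0]
    have := hC r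
    positivity

end ConjMoments

/-! Traces of alternating products of conjugated random matrices. -/

section TraceBound

variable {I : Type*} {N : ℕ}

/-- Since `E_ab M E_cd = M_bc E_ad`, the product collapses to one matrix unit, with one entry of
some `K i* K j`, `i ≠ j`, for each junction. -/
theorem exists_prod_single_eq (K : I → Matrix (Fin N) (Fin N) ℂ) (β : ℝ)
    (hK : ∀ i j, i ≠ j → ∀ a b, ‖(star (K i) * K j) a b‖ ≤ β)
    (l : List (I × (Bool → Fin N))) (x : I × (Bool → Fin N))
    (hl : (x :: l).IsChain fun x y => x.1 ≠ y.1) :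
    ∃ (θ : ℂ) (b : Fin N) (j : I), ‖θ‖ ≤ β ^ l.length ∧
      ((x :: l).map fun y =>
        K y.1 * Matrix.single (y.2 false) (y.2 true) 1 * star (K y.1)).prod =
      θ • (K x.1 * Matrix.single (x.2 false) b 1 * star (K j)) := by
  induction l generalizing x with
  | nil => exact ⟨1, x.2 true, x.1, by simp, by simp⟩
  | cons y l ih =>
    rw [List.isChain_cons_cons] at hl
    obtain ⟨θ, b, j, hθ, h⟩ := ih y hl.2
    refine ⟨θ * (star (K x.1) * K y.1) (x.2 true) (y.2 false), b, j, ?_, ?_⟩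
    · rw [norm_mul, List.length_cons, pow_succ]
      exact mul_le_mul hθ (hK _ _ hl.1 _ _) (norm_nonneg _) ((norm_nonneg _).trans hθ)
    · rw [List.map_cons, List.prod_cons, h, mul_smul_comm, mul_smul]
      congr 1
      have : K x.1 * Matrix.single (x.2 false) (x.2 true) 1 * star (K x.1) *
          (K y.1 * Matrix.single (y.2 false) b 1 * star (K j)) =
          K x.1 * (Matrix.single (x.2 false) (x.2 true) 1 * (star (K x.1) * K y.1) *
            Matrix.single (y.2 false) b 1) * star (K j) := by simp only [mul_assoc]
      rw [this, Matrix.single_mul_mul_single]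
      simp only [one_mul, mul_one]
      rw [← Matrix.smul_mul, ← Matrix.mul_smul, Matrix.smul_single, smul_eq_mul, mul_one]

theorem norm_trace_prod_single_le (K : I → Matrix (Fin N) (Fin N) ℂ) (β : ℝ)
    (hK : ∀ i j, i ≠ j → ∀ a b, ‖(star (K i) * K j) a b‖ ≤ β)
    (hK1 : ∀ i j a b, ‖(star (K i) * K j) a b‖ ≤ 1)
    (l : List (I × (Bool → Fin N))) (hl0 : l ≠ []) (hl : l.IsChain fun x y => x.1 ≠ y.1) :
    ‖(l.map fun y : I × (Bool → Fin N) =>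
        K y.1 * Matrix.single (y.2 false) (y.2 true) 1 * star (K y.1)).prod.trace‖ ≤
      β ^ (l.length - 1) := by
  obtain ⟨x, l, rfl⟩ := List.exists_cons_of_ne_nil hl0
  obtain ⟨θ, b, j, hθ, h⟩ := exists_prod_single_eq K β hK l x hl
  -- Closing the cycle adds one more entry, of `K j* K x.1`. The first and last indices may agree,
  -- so it is only bounded by `1`; hence the exponent `length - 1`.
  rw [h, Matrix.trace_smul, Matrix.trace_mul_comm, ← mul_assoc, Matrix.trace_mul_single,
    smul_eq_mul, norm_mul, MulOpposite.op_one, one_smul]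
  exact (mul_le_of_le_one_right (norm_nonneg _) (hK1 _ _ _ _)).trans hθ

theorem exists_norm_sum_trace_prod_conj_le (n : ℕ) :
    ∃ C : ℝ, 0 ≤ C ∧ ∀ (N : ℕ) (K : I → Matrix (Fin N) (Fin N) ℂ) (β : ℝ) (i : Fin n → I)
      (Z : Fin n → Matrix (Fin N) (Fin N) ℂ) (D : ℝ), 0 < n → 0 ≤ β →
      (List.ofFn i).IsChain (· ≠ ·) →
      (∀ i j, i ≠ j → ∀ a b, ‖(star (K i) * K j) a b‖ ≤ β) →
      (∀ i j a b, ‖(star (K i) * K j) a b‖ ≤ 1) →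
      (∀ a, (Z a).trace = 0) → 0 ≤ D → (∀ a, ∑ u, ∑ v, ‖Z a u v‖ ^ 2 ≤ D ^ 2) →
      ‖∑ W ∈ signedPermFinset N, (List.ofFn fun j =>
        K (i j) * (W * Z j * star W) * star (K (i j))).prod.trace‖ ≤
        (signedPermFinset N).card * (β ^ (n - 1) * (C * D ^ n)) := by
  classical
  obtain ⟨C, hC, h⟩ := exists_sum_norm_conjMoment_le (Fin n)
  refine ⟨C, hC, fun N K β i Z D hn hβ hi hK hK1 hZ hD hZD => ?_⟩
  set θ : (Fin n → Bool → Fin N) → ℂ := fun r => (List.ofFn fun j =>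
    K (i j) * Matrix.single (r j false) (r j true) 1 * star (K (i j))).prod.trace
  have hθ : ∀ r, ‖θ r‖ ≤ β ^ (n - 1) := by
    intro r
    have := norm_trace_prod_single_le K β hK hK1 (List.ofFn fun j => (i j, r j))
      (by rw [Ne, List.ofFn_eq_nil_iff]; omega)
      (by
        rw [List.isChain_ofFn] at hi ⊢
        exact hi)
    rwa [List.map_ofFn, List.length_ofFn] at this
  -- Multilinear expansion in matrix units: the coefficients `θ` do not involve `Y`, so the sum over
  -- `W` acts on the entries alone and produces `conjMoment`.
  have hexp : ∀ Y : Fin n → Matrix (Fin N) (Fin N) ℂ,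
      (List.ofFn fun j => K (i j) * Y j * star (K (i j))).prod.trace =
        ∑ r : Fin n → Bool → Fin N, edgeProd Y (fun x => r x.1 x.2) * θ r := by
    intro Y
    have hY : ∀ j, K (i j) * Y j * star (K (i j)) = ∑ c : Bool → Fin N,
        Y j (c false) (c true) •
          (K (i j) * Matrix.single (c false) (c true) 1 * star (K (i j))) := by
      intro j
      conv_lhs => rw [Matrix.matrix_eq_sum_single (Y j)]
      rw [Finset.mul_sum, Finset.sum_mul]
      have e := (Equiv.boolArrowEquivProd (Fin N)).symm.sum_comp fun c : Bool → Fin N =>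
        Y j (c false) (c true) •
          (K (i j) * Matrix.single (c false) (c true) 1 * star (K (i j)))
      rw [← e, Fintype.sum_prod_type]
      refine Finset.sum_congr rfl fun u _ => ?_
      rw [Finset.mul_sum, Finset.sum_mul]
      refine Finset.sum_congr rfl fun v _ => ?_
      simp only [Equiv.boolArrowEquivProd_symm_apply]
      rw [← Matrix.smul_mul, ← Matrix.mul_smul, Matrix.smul_single]
      simp
    simp only [hY]
    rw [← MultilinearMap.mkPiAlgebraFin_apply (R := ℂ), MultilinearMap.map_sum,
      Matrix.trace_sum]
    refine Finset.sum_congr rfl fun r _ => ?_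
    rw [MultilinearMap.map_smul_univ, Matrix.trace_smul, smul_eq_mul,
      MultilinearMap.mkPiAlgebraFin_apply]
    rfl
  simp only [hexp]
  rw [Finset.sum_comm]
  simp only [← Finset.sum_mul]
  calc ‖∑ r : Fin n → Bool → Fin N, conjMoment Z (fun x => r x.1 x.2) * θ r‖
      ≤ ∑ r : Fin n → Bool → Fin N, ‖conjMoment Z (fun x => r x.1 x.2)‖ * β ^ (n - 1) := by
        refine (norm_sum_le _ _).trans (Finset.sum_le_sum fun r _ => ?_)
        rw [norm_mul]
        exact mul_le_mul_of_nonneg_left (hθ r) (norm_nonneg _)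
    _ = (∑ i, ‖conjMoment Z i‖) * β ^ (n - 1) := by
        rw [← Finset.sum_mul]
        congr 1
        exact (Equiv.curry (Fin n) Bool (Fin N)).symm.sum_comp fun i => ‖conjMoment Z i‖
    _ ≤ _ := by
        have h' : ∑ i, ‖conjMoment Z i‖ ≤ (signedPermFinset N).card * (C * D ^ n) := by
          convert h N Z D hZ hD hZD
          exact (Fintype.card_fin n).symm
        refine (mul_le_mul_of_nonneg_right h' (pow_nonneg hβ (n - 1))).trans (le_of_eq ?_)
        ring

open scoped Matrix.Norms.L2Operator in
theorem sum_norm_sq_col_le_l2_opNorm (M : Matrix (Fin N) (Fin N) ℂ) (v : Fin N) :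
    ∑ u, ‖M u v‖ ^ 2 ≤ ‖M‖ ^ 2 := by
  have h := Matrix.l2_opNorm_mulVec M (EuclideanSpace.single v 1)
  rw [PiLp.norm_single, norm_one, mul_one] at h
  have h2 := pow_le_pow_left₀ (norm_nonneg _) h 2
  rw [EuclideanSpace.norm_sq_eq] at h2
  simpa using h2

open scoped Matrix.Norms.L2Operator in
theorem sum_norm_sq_le_l2_opNorm (M : Matrix (Fin N) (Fin N) ℂ) :
    ∑ u, ∑ v, ‖M u v‖ ^ 2 ≤ (√N * ‖M‖) ^ 2 := by
  rw [Finset.sum_comm, mul_pow, Real.sq_sqrt (Nat.cast_nonneg _)]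
  refine (Finset.sum_le_card_nsmul _ _ _ fun v _ =>
    sum_norm_sq_col_le_l2_opNorm M v).trans_eq ?_
  simp

end TraceBound

/-! Convergence of joint laws whose alternating centred moments vanish asymptotically. -/

theorem List.exists_append_of_not_isChain {α : Type*} {R : α → α → Prop} {l : List α}
    (h : ¬ l.IsChain R) : ∃ l₁ x y l₂, l = l₁ ++ x :: y :: l₂ ∧ ¬ R x y := by
  induction l with
  | nil => exact absurd List.IsChain.nil h
  | cons a l ih =>
    cases l with
    | nil => exact absurd (List.IsChain.singleton a) h
    | cons b l =>
      by_cases hab : R a b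
      · obtain ⟨l₁, x, y, l₂, hl, hxy⟩ := ih fun hl => h (List.isChain_cons_cons.2 ⟨hab, hl⟩)
        exact ⟨a :: l₁, x, y, l₂, by rw [hl]; rfl, hxy⟩
      · exact ⟨[], a, b, l, rfl, hab⟩

section FreeLimit

variable {I : Type*}

/-- The centring of a noncommutative polynomial with respect to a linear functional. -/
def freeCenter (τ : FreeAlgebra ℂ I →ₗ[ℂ] ℂ) (p : FreeAlgebra ℂ I) : FreeAlgebra ℂ I :=
  p - algebraMap ℂ _ (τ p)

/-- The moment of a product of polynomials, centred for the first list only. -/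
def mixedMoment (τ : FreeAlgebra ℂ I →ₗ[ℂ] ℂ) (l₁ l₂ : List (I × FreeAlgebra ℂ I)) : ℂ :=
  τ ((l₁.map fun x => freeCenter τ x.2).prod * (l₂.map Prod.snd).prod)

theorem mixedMoment_append_singleton (τ : FreeAlgebra ℂ I →ₗ[ℂ] ℂ)
    (l₁ l₂ : List (I × FreeAlgebra ℂ I)) (x : I × FreeAlgebra ℂ I) :
    mixedMoment τ (l₁ ++ [x]) l₂ =
      mixedMoment τ l₁ (x :: l₂) - τ x.2 * mixedMoment τ l₁ l₂ := by
  simp only [mixedMoment, List.map_append, List.prod_append, List.map_cons, List.map_nil,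
    List.prod_cons, List.prod_nil, mul_one, freeCenter, mul_sub, sub_mul, map_sub]
  congr 1
  · rw [mul_assoc]
  · rw [← smul_eq_mul (τ x.2), ← map_smul, ← Algebra.commutes, mul_assoc, Algebra.smul_def]

variable {τ : ℕ → FreeAlgebra ℂ I →ₗ[ℂ] ℂ}

theorem exists_tendsto_of_mem_adjoin
    (hm : ∀ i k, ∃ c, Tendsto (fun N => τ N (FreeAlgebra.ι ℂ i ^ k)) atTop (𝓝 c))
    (i : I) (p : FreeAlgebra ℂ I) (hp : p ∈ Algebra.adjoin ℂ {FreeAlgebra.ι ℂ i}) :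
    ∃ c, Tendsto (fun N => τ N p) atTop (𝓝 c) := by
  rw [Algebra.adjoin_singleton_eq_range_aeval] at hp
  obtain ⟨q, rfl⟩ := hp
  choose c hc using hm i
  refine ⟨∑ k ∈ Finset.range (q.natDegree + 1), q.coeff k * c k, ?_⟩
  simp only [AlgHom.toRingHom_eq_coe, RingHom.coe_coe, Polynomial.aeval_eq_sum_range, map_sum,
    map_smul, smul_eq_mul]
  exact tendsto_finsetSum _ fun k _ => (hc k).const_mul _

/-- Induction on the number of factors. Centring one factor changes the moment by a one-variable
moment times a shorter mixed moment, both convergent, so it does not matter which factors are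
centred. An alternating list can be centred completely; in any other list two neighbours in the same
variable merge. -/
theorem exists_tendsto_mixedMoment
    (h1 : Tendsto (fun N => τ N 1) atTop (𝓝 1))
    (hm : ∀ i k, ∃ c, Tendsto (fun N => τ N (FreeAlgebra.ι ℂ i ^ k)) atTop (𝓝 c))
    (hc : ∀ l : List (I × FreeAlgebra ℂ I), 2 ≤ l.length → l.IsChain (fun x y => x.1 ≠ y.1) →
      (∀ x ∈ l, x.2 ∈ Algebra.adjoin ℂ {FreeAlgebra.ι ℂ x.1}) →
      Tendsto (fun N => τ N (l.map fun x => freeCenter (τ N) x.2).prod) atTop (𝓝 0))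
    (k : ℕ) (l₁ l₂ : List (I × FreeAlgebra ℂ I))
    (hl : ∀ x ∈ l₁ ++ l₂, x.2 ∈ Algebra.adjoin ℂ {FreeAlgebra.ι ℂ x.1})
    (hk : (l₁ ++ l₂).length = k) :
    ∃ c, Tendsto (fun N => mixedMoment (τ N) l₁ l₂) atTop (𝓝 c) := by
  have hm' := exists_tendsto_of_mem_adjoin hm
  induction k generalizing l₁ l₂ with
  | zero =>
    obtain ⟨rfl, rfl⟩ : l₁ = [] ∧ l₂ = [] := by simpa using hk
    exact ⟨1, by simpa [mixedMoment] using h1⟩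
  | succ k ih =>
    have step : ∀ l₁ l₂ x, (∀ y ∈ l₁ ++ x :: l₂, y.2 ∈ Algebra.adjoin ℂ {FreeAlgebra.ι ℂ y.1}) →
        (l₁ ++ x :: l₂).length = k + 1 →
        ((∃ c, Tendsto (fun N => mixedMoment (τ N) (l₁ ++ [x]) l₂) atTop (𝓝 c)) ↔
          ∃ c, Tendsto (fun N => mixedMoment (τ N) l₁ (x :: l₂)) atTop (𝓝 c)) := by
      intro l₁ l₂ x hl hk
      obtain ⟨a, ha⟩ := hm' x.1 x.2 (hl x (by simp))
      obtain ⟨b, hb⟩ := ih l₁ l₂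
        (fun y hy => hl y (by simp only [List.mem_append, List.mem_cons] at hy ⊢; tauto))
        (by simp only [List.length_append, List.length_cons] at hk ⊢; omega)
      simp only [mixedMoment_append_singleton]
      constructor
      · rintro ⟨c, hc⟩
        exact ⟨c + a * b, by simpa using hc.add (ha.mul hb)⟩
      · rintro ⟨c, hc⟩
        exact ⟨c - a * b, hc.sub (ha.mul hb)⟩
    have all : ∀ l₁ l₂, (∀ y ∈ l₁ ++ l₂, y.2 ∈ Algebra.adjoin ℂ {FreeAlgebra.ι ℂ y.1}) →
        (l₁ ++ l₂).length = k + 1 →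
        ((∃ c, Tendsto (fun N => mixedMoment (τ N) l₁ l₂) atTop (𝓝 c)) ↔
          ∃ c, Tendsto (fun N => mixedMoment (τ N) [] (l₁ ++ l₂)) atTop (𝓝 c)) := by
      intro l₁
      induction l₁ using List.reverseRecOn with
      | nil => intro l₂ _ _; rfl
      | append_singleton l₁ x ihl =>
        intro l₂ hl hk
        simp only [List.append_assoc, List.singleton_append] at hl hk ⊢
        rw [step l₁ l₂ x hl hk, ihl _ hl hk]
    rw [all l₁ l₂ hl hk]
    generalize l₁ ++ l₂ = l at hl hk
    by_cases hch : l.IsChain fun x y => x.1 ≠ y.1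
    · by_cases h2 : 2 ≤ l.length
      · have := (all l [] (by simpa using hl) (by simpa using hk)).1
          ⟨0, by simpa [mixedMoment] using hc l h2 hch hl⟩
        simpa using this
      · obtain ⟨x, rfl⟩ : ∃ x, l = [x] := List.length_eq_one_iff.1 (by omega)
        simpa [mixedMoment] using hm' x.1 x.2 (hl x (by simp))
    · obtain ⟨l₁, x, y, l₂, rfl, hxy⟩ := List.exists_append_of_not_isChain hch
      rw [not_not] at hxy
      obtain ⟨c, hc⟩ := ih [] (l₁ ++ (x.1, x.2 * y.2) :: l₂) (by
        intro z hz
        simp only [List.nil_append, List.mem_append, List.mem_cons] at hz hl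
        rcases hz with hz | rfl | hz
        · exact hl z (Or.inl hz)
        · refine mul_mem (hl x (by simp)) ?_
          have := hl y (by simp)
          rwa [← hxy] at this
        · exact hl z (by simp [hz]))
        (by simp only [List.nil_append, List.length_append, List.length_cons] at hk ⊢; omega)
      refine ⟨c, ?_⟩
      simpa [mixedMoment, mul_assoc] using hc

theorem exists_free_limit
    (h1 : Tendsto (fun N => τ N 1) atTop (𝓝 1))
    (hm : ∀ i k, ∃ c, Tendsto (fun N => τ N (FreeAlgebra.ι ℂ i ^ k)) atTop (𝓝 c))
    (hc : ∀ l : List (I × FreeAlgebra ℂ I), 2 ≤ l.length → l.IsChain (fun x y => x.1 ≠ y.1) →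
      (∀ x ∈ l, x.2 ∈ Algebra.adjoin ℂ {FreeAlgebra.ι ℂ x.1}) →
      Tendsto (fun N => τ N (l.map fun x => freeCenter (τ N) x.2).prod) atTop (𝓝 0)) :
    ∃ σ : FreeAlgebra ℂ I →ₗ[ℂ] ℂ, (∀ f, Tendsto (fun N => τ N f) atTop (𝓝 (σ f))) ∧
      FreeFamily σ (FreeAlgebra.ι ℂ) := by
  have hall : ∀ f, ∃ c, Tendsto (fun N => τ N f) atTop (𝓝 c) := by
    intro f
    have hf : f ∈ Subalgebra.toSubmodule
        (Algebra.adjoin ℂ (Set.range (FreeAlgebra.ι ℂ (X := I)))) := by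
      rw [FreeAlgebra.adjoin_range_ι]; trivial
    rw [Algebra.adjoin_eq_span] at hf
    induction hf using Submodule.span_induction with
    | mem f hf =>
      obtain ⟨l, hl, rfl⟩ := Submonoid.exists_list_of_mem_closure hf
      obtain ⟨l, rfl⟩ : l ∈ Set.range (List.map (FreeAlgebra.ι ℂ (X := I))) := by
        rw [Set.range_list_map]; exact hl
      obtain ⟨c, hc⟩ := exists_tendsto_mixedMoment h1 hm hc _ []
        (l.map fun i => (i, FreeAlgebra.ι ℂ i)) (by
          intro x hx
          obtain ⟨i, _, rfl⟩ := List.mem_map.1 hx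
          exact Algebra.subset_adjoin rfl) rfl
      refine ⟨c, ?_⟩
      simpa [mixedMoment, Function.comp_def] using hc
    | zero => exact ⟨0, by simp⟩
    | add f g _ _ hf hg =>
      obtain ⟨a, ha⟩ := hf
      obtain ⟨b, hb⟩ := hg
      exact ⟨a + b, by simpa using ha.add hb⟩
    | smul r f _ hf =>
      obtain ⟨a, ha⟩ := hf
      exact ⟨r * a, by simpa using ha.const_mul r⟩
  choose s hs using hall
  let σ : FreeAlgebra ℂ I →ₗ[ℂ] ℂ := linearMapOfTendsto s τ (tendsto_pi_nhds.2 hs)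
  have hσ : ∀ f, Tendsto (fun N => τ N f) atTop (𝓝 (σ f)) := hs
  refine ⟨σ, hσ, fun l h2 hch hl => ?_⟩
  -- For factors centred under the limit, centring under `τ N` is asymptotically invisible: its
  -- correction is a null sequence times a convergent one. The centred moments thus tend both to the
  -- limit moment and to `0`.
  have hlim : ∀ l₁ l₂ : List (I × FreeAlgebra ℂ I),
      (∀ x ∈ l₁ ++ l₂, x.2 ∈ Algebra.adjoin ℂ {FreeAlgebra.ι ℂ x.1} ∧ σ x.2 = 0) →
      Tendsto (fun N => mixedMoment (τ N) l₁ l₂) atTop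
        (𝓝 (σ ((l₁ ++ l₂).map Prod.snd).prod)) := by
    intro l₁
    induction l₁ using List.reverseRecOn with
    | nil => intro l₂ _; simpa [mixedMoment] using hσ _
    | append_singleton l₁ x ih =>
      intro l₂ hl
      simp only [List.append_assoc, List.singleton_append] at hl ⊢
      simp only [mixedMoment_append_singleton]
      obtain ⟨c, hc⟩ := exists_tendsto_mixedMoment h1 hm hc _ l₁ l₂ (fun y hy => (hl y (by
        simp only [List.mem_append, List.mem_cons] at hy ⊢; tauto)).1) rfl
      have hx : Tendsto (fun N => τ N x.2) atTop (𝓝 0) := by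
        have := hσ x.2
        rwa [(hl x (by simp)).2] at this
      simpa using (ih _ hl).sub (hx.mul hc)
  have key := hlim l [] (by simpa using hl)
  have h0 := hc l h2 hch fun x hx => (hl x hx).1
  simp only [mixedMoment, List.map_nil, List.prod_nil, mul_one, List.append_nil] at key
  exact tendsto_nhds_unique key h0

end FreeLimit

/-- The sequence alternating between `τ` and `τ'` satisfies the hypotheses of `exists_free_limit`,
so it converges; its even and odd subsequences are constant. -/
theorem IsFreePairLaw.unique {μ ν : Measure ℝ} {τ τ' : FreeAlgebra ℂ (Fin 2) →ₗ[ℂ] ℂ}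
    (h : IsFreePairLaw μ ν τ) (h' : IsFreePairLaw μ ν τ') : τ = τ' := by
  have hall : ∀ N : ℕ, IsFreePairLaw μ ν (if Even N then τ else τ') := by
    intro N; split_ifs <;> assumption
  obtain ⟨σ, hσ, -⟩ := exists_free_limit (τ := fun N : ℕ => if Even N then τ else τ')
    (by simp [fun N => (hall N).map_one])
    (fun i k => by
      fin_cases i
      · exact ⟨_, by
          simp only [Fin.zero_eta, fun N => (hall N).left k]
          exact tendsto_const_nhds⟩
      · exact ⟨_, by
          simp only [Fin.mk_one, fun N => (hall N).right k]
          exact tendsto_const_nhds⟩)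
    (fun l h2 hch hl => by
      refine tendsto_const_nhds.congr fun N => ?_
      symm
      have := (hall N).free
        (l.map fun x => (x.1, freeCenter (if Even N then τ else τ') x.2)) (by simpa using h2)
        ((List.isChain_map _).2 hch) (by
          intro y hy
          obtain ⟨x, hx, rfl⟩ := List.mem_map.1 hy
          refine ⟨sub_mem (hl x hx) (algebraMap_mem _ _), ?_⟩
          simp only [freeCenter]
          rw [map_sub, Algebra.algebraMap_eq_smul_one, map_smul, (hall N).map_one]
          simp)
      simpa [Function.comp_def] using this)
  have e : ∀ f, τ f = σ f := fun f => by
    have := (hσ f).comp (tendsto_id.const_mul_atTop' (show 0 < 2 by norm_num))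
    refine tendsto_nhds_unique (tendsto_const_nhds.congr fun N => ?_) this
    simp
  have e' : ∀ f, τ' f = σ f := fun f => by
    have := (hσ f).comp ((tendsto_add_atTop_nat 1).comp
      (tendsto_id.const_mul_atTop' (show 0 < 2 by norm_num)))
    refine tendsto_nhds_unique (tendsto_const_nhds.congr fun N => ?_) this
    simp
  exact LinearMap.ext fun f => (e f).trans (e' f).symm

/-! Limits of the moments of averaged spectral distributions. -/

section SpectralMoments

open scoped Matrix.Norms.L2Operator

theorem Matrix.IsHermitian.trace_pow_eq_sum {n : Type*} [Fintype n] [DecidableEq n]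
    {X : Matrix n n ℂ} (hX : X.IsHermitian) (k : ℕ) :
    (X ^ k).trace = ∑ i, ((hX.eigenvalues i ^ k : ℝ) : ℂ) := by
  conv_lhs => rw [hX.spectral_theorem]
  rw [← map_pow, Matrix.diagonal_pow, Unitary.conjStarAlgAut_apply, Matrix.trace_mul_comm,
    ← mul_assoc]
  simp [Matrix.trace_diagonal]

theorem Matrix.IsHermitian.abs_eigenvalues_le {n : Type*} [Fintype n] [DecidableEq n]
    {X : Matrix n n ℂ} (hX : X.IsHermitian) (i : n) : |hX.eigenvalues i| ≤ ‖X‖ := by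
  have h := Matrix.l2_opNorm_mulVec X (hX.eigenvectorBasis i)
  have h2 : (EuclideanSpace.equiv n ℂ).symm (X *ᵥ (hX.eigenvectorBasis i)) =
      hX.eigenvalues i • hX.eigenvectorBasis i := by
    rw [hX.mulVec_eigenvectorBasis]
    rfl
  rw [h2, norm_smul, hX.eigenvectorBasis.orthonormal.1 i] at h
  simpa using h

theorem exists_probabilityMeasure_integral_eq_average {J K : Type*} [Fintype J] [Nonempty J]
    [MeasurableSpace K] (y : J → K) :
    ∃ ν : ProbabilityMeasure K, ∀ f : K → ℝ, StronglyMeasurable f →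
      ∫ x, f x ∂(ν : Measure K) = (Fintype.card J : ℝ)⁻¹ * ∑ j, f (y j) := by
  let _ : MeasurableSpace J := ⊤
  have hy : Measurable y := fun _ _ => trivial
  have := Measure.isProbabilityMeasure_map (μ := (PMF.uniformOfFintype J).toMeasure) hy.aemeasurable
  refine ⟨⟨(PMF.uniformOfFintype J).toMeasure.map y, this⟩, fun f hf => ?_⟩
  change ∫ x, f x ∂((PMF.uniformOfFintype J).toMeasure.map y) = _
  rw [integral_map hy.aemeasurable hf.aestronglyMeasurable, PMF.integral_eq_sum]
  simp [Finset.mul_sum]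

/-- The averages are the moments of mean empirical eigenvalue distributions on `[-R, R]`, and
probability measures on a compact interval form a compact space. -/
theorem exists_isBoundedLaw_of_tendsto {β : ℕ → Type*} (s : ∀ N, Finset (β N))
    (hs : ∀ N, (s N).Nonempty) (X : ∀ N, β N → Matrix (Fin N) (Fin N) ℂ) (R : ℝ) (hR : 0 ≤ R)
    (hX : ∀ N, ∀ w ∈ s N, (X N w).IsHermitian) (hXR : ∀ N, ∀ w ∈ s N, ‖X N w‖ ≤ R)
    (m : ℕ → ℂ) (hm : ∀ k, Tendsto (fun N : ℕ => (N : ℂ)⁻¹ * (((s N).card : ℂ)⁻¹ *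
      ∑ w ∈ s N, (X N w ^ k).trace)) atTop (𝓝 (m k))) :
    ∃ ρ : Measure ℝ, IsBoundedLaw ρ ∧ ∀ k, m k = ((∫ x, x ^ k ∂ρ : ℝ) : ℂ) := by
  have h0 : (0 : ℝ) ∈ Set.Icc (-R) R := ⟨by linarith, hR⟩
  have hν : ∀ N : ℕ, ∃ ν : ProbabilityMeasure (Set.Icc (-R) R), N ≠ 0 → ∀ k : ℕ,
      ((∫ x, (x : ℝ) ^ k ∂(ν : Measure (Set.Icc (-R) R)) : ℝ) : ℂ) =
        (N : ℂ)⁻¹ * (((s N).card : ℂ)⁻¹ * ∑ w ∈ s N, (X N w ^ k).trace) := by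
    intro N
    by_cases hN : N = 0
    · exact ⟨⟨Measure.dirac ⟨0, h0⟩, inferInstance⟩, fun h => absurd hN h⟩
    have : NeZero N := ⟨hN⟩
    have : Nonempty (s N) := (hs N).to_subtype
    obtain ⟨ν, hν⟩ := exists_probabilityMeasure_integral_eq_average
      (fun j : s N × Fin N => (⟨(hX N j.1 j.1.2).eigenvalues j.2, abs_le.1
        (((hX N j.1 j.1.2).abs_eigenvalues_le j.2).trans (hXR N j.1 j.1.2))⟩ : Set.Icc (-R) R))
    refine ⟨ν, fun _ k => ?_⟩
    have hsum : ∑ w ∈ s N, (X N w ^ k).trace =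
        ∑ w : s N, ∑ i, (((hX N w w.2).eigenvalues i ^ k : ℝ) : ℂ) := by
      rw [← Finset.sum_coe_sort]
      exact Finset.sum_congr rfl fun w _ => (hX N w w.2).trace_pow_eq_sum k
    rw [hν (fun x => (x : ℝ) ^ k) (by fun_prop), hsum, Fintype.sum_prod_type]
    simp only [Fintype.card_prod, Fintype.card_coe, Fintype.card_fin]
    push_cast
    rw [mul_inv]
    ring
  choose ν hν using hν
  -- A limit along an ultrafilter suffices, because the moments already converge along `atTop`.
  set 𝒰 : Ultrafilter (ProbabilityMeasure (Set.Icc (-R) R)) := (hyperfilter ℕ).map ν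
  have hlim : Tendsto ν (hyperfilter ℕ) (𝓝 𝒰.lim) := 𝒰.le_nhds_lim
  rw [ProbabilityMeasure.tendsto_iff_forall_integral_tendsto] at hlim
  have hcont : ∀ k : ℕ, Continuous fun x : Set.Icc (-R) R => (x : ℝ) ^ k := fun k => by fun_prop
  refine ⟨(𝒰.lim : Measure (Set.Icc (-R) R)).map Subtype.val,
    ⟨Measure.isProbabilityMeasure_map measurable_subtype_coe.aemeasurable, R, ?_⟩, fun k => ?_⟩
  · rw [ae_map_iff measurable_subtype_coe.aemeasurable
      (measurableSet_le continuous_abs.measurable measurable_const)]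
    exact Eventually.of_forall fun x => abs_le.2 x.2
  · rw [integral_map measurable_subtype_coe.aemeasurable (by fun_prop)]
    have h1 := hlim (BoundedContinuousFunction.mkOfCompact ⟨_, hcont k⟩)
    have h2 := ((hm k).mono_left Nat.hyperfilter_le_atTop)
    refine tendsto_nhds_unique h2 (((Complex.continuous_ofReal.tendsto _).comp h1).congr' ?_)
    filter_upwards [Nat.hyperfilter_le_atTop (eventually_ne_atTop 0)] with N hN
    exact hν N hN k

end SpectralMoments

/-! Expectations over a uniformly distributed signed permutation matrix. -/

section Expectation

variable {Ω : Type*} [MeasurableSpace Ω] {N : ℕ} {P : Measure Ω}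

theorem IsUniformSignedPerm.integral_comp {W : Ω → Matrix (Fin N) (Fin N) ℂ}
    (hW : IsUniformSignedPerm P W) (g : Matrix (Fin N) (Fin N) ℂ → ℂ) :
    ∫ ω, g (W ω) ∂P =
      ((signedPermFinset N).card : ℂ)⁻¹ * ∑ w ∈ signedPermFinset N, g w := by
  classical
  have : MeasurableSingletonClass (Matrix (Fin N) (Fin N) ℂ) :=
    inferInstanceAs (MeasurableSingletonClass (Fin N → Fin N → ℂ))
  -- An arbitrary `g` is replaced by a measurable function that agrees with it on the finite support
  -- of the law.
  set g' : Matrix (Fin N) (Fin N) ℂ → ℂ := fun x =>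
    ∑ w ∈ signedPermFinset N, ({w} : Set (Matrix (Fin N) (Fin N) ℂ)).indicator (fun _ => g w) x
  have hmeas : StronglyMeasurable g' := (Finset.measurable_fun_sum _ fun w _ =>
    measurable_const.indicator (measurableSet_singleton w)).stronglyMeasurable
  have hms : MeasurableSet (signedPermMatrices N) := (signedPermMatrices_finite N).measurableSet
  have hlaw : P.map W = uniformOn (signedPermMatrices N) := HasLaw.map_eq hW
  have hae : g =ᵐ[P.map W] g' := by
    rw [hlaw]
    filter_upwards [ae_cond_mem hms] with x hx
    simp only [g']
    rw [Finset.sum_eq_single x]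
    · simp
    · intro w _ hw
      simp [hw.symm]
    · exact fun h => absurd (mem_signedPermFinset.2 hx) h
  have hs : ∀ w ∈ signedPermFinset N, (uniformOn (signedPermMatrices N)).real {w} =
      ((signedPermFinset N).card : ℝ)⁻¹ := by
    intro w hw
    have hw' := mem_signedPermFinset.1 hw
    rw [measureReal_def, uniformOn, cond_apply hms, Set.inter_eq_right.2 (by simpa using hw'),
      Measure.count_singleton, Measure.count_apply_finite _ (signedPermMatrices_finite N)]
    simp [signedPermFinset]
  have : IsFiniteMeasure (uniformOn (signedPermMatrices N)) := by
    unfold uniformOn; infer_instance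
  rw [← integral_map (f := g) (HasLaw.aemeasurable hW)
    (hmeas.aestronglyMeasurable.congr hae.symm), integral_congr_ae hae, hlaw]
  simp only [g']
  rw [integral_finsetSum _ fun w _ => (integrable_const _).indicator (measurableSet_singleton w),
    Finset.mul_sum]
  refine Finset.sum_congr rfl fun w hw => ?_
  rw [integral_indicator_const _ (measurableSet_singleton w), hs w hw]
  simp

variable [IsProbabilityMeasure P]

theorem IsUniformSignedPerm.matrixState_eq {W : Ω → Matrix (Fin N) (Fin N) ℂ}
    (hW : IsUniformSignedPerm P W) (Z : BddRandomMatrix N P)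
    (G : Matrix (Fin N) (Fin N) ℂ → Matrix (Fin N) (Fin N) ℂ) (hG : ∀ ω, Z.1 ω = G (W ω)) :
    matrixState N P Z =
      (N : ℂ)⁻¹ * (((signedPermFinset N).card : ℂ)⁻¹ * ∑ w ∈ signedPermFinset N, (G w).trace) := by
  rw [← hW.integral_comp fun w => (G w).trace]
  change (N : ℂ)⁻¹ * ∫ ω, (Z.1 ω).trace ∂P = _
  simp only [hG]

/-- The value of a random matrix at a sample point. -/
def BddRandomMatrix.evalAlgHom (ω : Ω) : BddRandomMatrix N P →ₐ[ℂ] Matrix (Fin N) (Fin N) ℂ :=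
  (Pi.evalAlgHom ℂ (fun _ : Ω => Matrix (Fin N) (Fin N) ℂ) ω).comp
    (BddRandomMatrix N P).toSubalgebra.val

end Expectation

/-! ### Reduction of the fake Haar pair to the fixed unitaries `1` and `H / √N`. -/

section FakeHaar

variable {N : ℕ}

/-- The value of the fake Haar unitary at the signed permutation matrix `w`. -/
noncomputable def fakeHaarMatrix (H w : Matrix (Fin N) (Fin N) ℂ) : Matrix (Fin N) (Fin N) ℂ :=
  ((√(N : ℝ) : ℝ) : ℂ)⁻¹ • (star w * H * w)

/-- The values of the pair `A, U B U*` at the signed permutation matrix `w`. -/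
noncomputable def fakeHaarPair (H A B w : Matrix (Fin N) (Fin N) ℂ) :
    Fin 2 → Matrix (Fin N) (Fin N) ℂ :=
  ![A, fakeHaarMatrix H w * B * star (fakeHaarMatrix H w)]

theorem jointLaw_fakeHaar {Ω : Type*} [MeasurableSpace Ω] {P : Measure Ω} [IsProbabilityMeasure P]
    {W : Ω → Matrix (Fin N) (Fin N) ℂ} (hW : IsUniformSignedPerm P W)
    (H A B : Matrix (Fin N) (Fin N) ℂ) (f : FreeAlgebra ℂ (Fin 2)) :
    jointLaw (matrixState N P) ![constMatrix P A,
      fakeHaar hW H * constMatrix P B * star (fakeHaar hW H)] f =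
    (N : ℂ)⁻¹ * (((signedPermFinset N).card : ℂ)⁻¹ * ∑ w ∈ signedPermFinset N,
      (FreeAlgebra.lift ℂ (fakeHaarPair H A B w) f).trace) := by
  refine hW.matrixState_eq _ (fun w => FreeAlgebra.lift ℂ (fakeHaarPair H A B w) f) fun ω => ?_
  have : (BddRandomMatrix.evalAlgHom (P := P) ω).comp (FreeAlgebra.lift ℂ ![constMatrix P A,
      fakeHaar hW H * constMatrix P B * star (fakeHaar hW H)]) =
      FreeAlgebra.lift ℂ (fakeHaarPair H A B (W ω)) := by
    refine FreeAlgebra.hom_ext (funext fun i => ?_)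
    fin_cases i
    · simp [fakeHaarPair]
      rfl
    · simp [fakeHaarPair]
      rfl
  exact DFunLike.congr_fun this f

/-- The two unitaries `1` and `H / √N`. -/
noncomputable def hadamardPair (H : Matrix (Fin N) (Fin N) ℂ) :
    Fin 2 → Matrix (Fin N) (Fin N) ℂ :=
  ![1, ((√(N : ℝ) : ℝ) : ℂ)⁻¹ • H]

theorem IsComplexHadamard.hadamardPair_star_mul_self {H : Matrix (Fin N) (Fin N) ℂ}
    (hH : IsComplexHadamard H) (i : Fin 2) : star (hadamardPair H i) * hadamardPair H i = 1 := by
  fin_cases i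
  · simp [hadamardPair]
  · exact Matrix.mem_unitaryGroup_iff'.1 hH.unitary

/-- The product is `H / √N` or its adjoint. This is where the unimodularity of the entries enters.
-/
theorem IsComplexHadamard.norm_star_mul_of_ne {H : Matrix (Fin N) (Fin N) ℂ}
    (hH : IsComplexHadamard H) (i j : Fin 2) (hij : i ≠ j) (a b : Fin N) :
    ‖(star (hadamardPair H i) * hadamardPair H j) a b‖ ≤ (√(N : ℝ))⁻¹ := by
  fin_cases i <;> fin_cases j
  · exact absurd rfl hij
  · simp [hadamardPair, hH.norm_entry, abs_of_nonneg (Real.sqrt_nonneg _)]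
  · simp [hadamardPair, hH.norm_entry, Matrix.star_apply, abs_of_nonneg (Real.sqrt_nonneg _)]
  · exact absurd rfl hij

theorem IsComplexHadamard.norm_star_mul_le_one {H : Matrix (Fin N) (Fin N) ℂ}
    (hH : IsComplexHadamard H) (i j : Fin 2) (a b : Fin N) :
    ‖(star (hadamardPair H i) * hadamardPair H j) a b‖ ≤ 1 := by
  by_cases hij : i = j
  · subst hij
    rw [hH.hadamardPair_star_mul_self, Matrix.one_apply]
    split_ifs <;> simp
  · refine (hH.norm_star_mul_of_ne i j hij a b).trans (inv_le_one_of_one_le₀ ?_)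
    rw [Real.one_le_sqrt]
    exact_mod_cast (Fin.pos a)

theorem hadamardPair_conj_eq {w : Matrix (Fin N) (Fin N) ℂ} (hw : w ∈ signedPermMatrices N)
    (H A B : Matrix (Fin N) (Fin N) ℂ) (i : Fin 2) :
    fakeHaarPair H A B w i = star w * (hadamardPair H i * (w * ![A, B] i * star w) *
      star (hadamardPair H i)) * w := by
  have h1 := signedPermMatrices_star_mul_self hw
  fin_cases i
  · simp only [fakeHaarPair, hadamardPair, Fin.zero_eta, Matrix.cons_val_zero, star_one, one_mul,
      mul_one]
    rw [← mul_assoc, ← mul_assoc, h1, one_mul, mul_assoc, h1, mul_one]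
  · simp [fakeHaarPair, hadamardPair, fakeHaarMatrix, mul_assoc]

theorem lift_fakeHaarPair_of_mem_adjoin {w H : Matrix (Fin N) (Fin N) ℂ}
    (hw : w ∈ signedPermMatrices N) (hH : IsComplexHadamard H) (A B : Matrix (Fin N) (Fin N) ℂ)
    (i : Fin 2) {p : FreeAlgebra ℂ (Fin 2)} (hp : p ∈ Algebra.adjoin ℂ {FreeAlgebra.ι ℂ i}) :
    FreeAlgebra.lift ℂ (fakeHaarPair H A B w) p =
      star w * (hadamardPair H i * (w * FreeAlgebra.lift ℂ ![A, B] p * star w) *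
        star (hadamardPair H i)) * w := by
  -- `V` is unitary, so conjugation by it is an algebra homomorphism and passes from the generator
  -- to its polynomials.
  set V := star w * hadamardPair H i * w with hV
  have h1 := signedPermMatrices_star_mul_self hw
  have h2 := signedPermMatrices_mul_star_self hw
  have hc : ∀ M, star w * (hadamardPair H i * (w * M * star w) * star (hadamardPair H i)) * w =
      V * M * star V := by
    intro M
    simp [hV, mul_assoc]
  have hVV : star V * V = 1 := by
    rw [hV]
    simp only [star_mul, star_star, mul_assoc]
    rw [← mul_assoc w, h2, one_mul, ← mul_assoc (star (hadamardPair H i)),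
      hH.hadamardPair_star_mul_self, one_mul, h1]
  have hVV' : V * star V = 1 := mul_eq_one_comm.1 hVV
  rw [hc]
  induction hp using Algebra.adjoin_induction with
  | mem x hx =>
    obtain rfl : x = FreeAlgebra.ι ℂ i := hx
    rw [FreeAlgebra.lift_ι_apply, FreeAlgebra.lift_ι_apply, hadamardPair_conj_eq hw, hc]
  | algebraMap r =>
    rw [AlgHom.commutes, AlgHom.commutes, ← Algebra.commutes, mul_assoc, hVV', mul_one]
  | add x y _ _ hx hy => rw [map_add, map_add, hx, hy, mul_add, add_mul]
  | mul x y _ _ hx hy =>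
    rw [map_mul, map_mul, hx, hy]
    calc _ = V * FreeAlgebra.lift ℂ ![A, B] x * (star V * V) * FreeAlgebra.lift ℂ ![A, B] y *
          star V := by simp only [mul_assoc]
      _ = _ := by rw [hVV, mul_one, mul_assoc V]

theorem trace_lift_fakeHaarPair_of_mem_adjoin {w H : Matrix (Fin N) (Fin N) ℂ}
    (hw : w ∈ signedPermMatrices N) (hH : IsComplexHadamard H) (A B : Matrix (Fin N) (Fin N) ℂ)
    (i : Fin 2) {p : FreeAlgebra ℂ (Fin 2)} (hp : p ∈ Algebra.adjoin ℂ {FreeAlgebra.ι ℂ i}) :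
    (FreeAlgebra.lift ℂ (fakeHaarPair H A B w) p).trace =
      (FreeAlgebra.lift ℂ ![A, B] p).trace := by
  rw [lift_fakeHaarPair_of_mem_adjoin hw hH A B i hp, Matrix.trace_mul_comm, ← mul_assoc,
    signedPermMatrices_mul_star_self hw, one_mul, Matrix.trace_mul_comm, ← mul_assoc,
    hH.hadamardPair_star_mul_self, one_mul, Matrix.trace_mul_comm, ← mul_assoc,
    signedPermMatrices_star_mul_self hw, one_mul]

theorem fakeHaarMatrix_mem_unitary {w H : Matrix (Fin N) (Fin N) ℂ}
    (hw : w ∈ signedPermMatrices N) (hH : IsComplexHadamard H) :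
    fakeHaarMatrix H w ∈ unitary (Matrix (Fin N) (Fin N) ℂ) := by
  have h : fakeHaarMatrix H w =
      star w * (((√(N : ℝ) : ℝ) : ℂ)⁻¹ • H) * w := by simp [fakeHaarMatrix]
  have hw' : w ∈ unitary (Matrix (Fin N) (Fin N) ℂ) :=
    ⟨signedPermMatrices_star_mul_self hw, signedPermMatrices_mul_star_self hw⟩
  rw [h]
  exact mul_mem (mul_mem (Unitary.star_mem hw') hH.unitary) hw'

theorem list_prod_map_conj {α : Type*} {w : Matrix (Fin N) (Fin N) ℂ}
    (hw : w ∈ signedPermMatrices N) (l : List α) (F : α → Matrix (Fin N) (Fin N) ℂ) :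
    (l.map fun x => star w * F x * w).prod = star w * (l.map F).prod * w := by
  induction l with
  | nil => simp [signedPermMatrices_star_mul_self hw]
  | cons x l ih =>
    rw [List.map_cons, List.prod_cons, ih, List.map_cons, List.prod_cons]
    calc _ = star w * F x * (w * star w) * (l.map F).prod * w := by simp only [mul_assoc]
      _ = _ := by rw [signedPermMatrices_mul_star_self hw, mul_one, mul_assoc (star w)]

theorem jointLaw_fakeHaar_of_mem_adjoin {Ω : Type*} [MeasurableSpace Ω] {P : Measure Ω}
    [IsProbabilityMeasure P] {W : Ω → Matrix (Fin N) (Fin N) ℂ} (hW : IsUniformSignedPerm P W)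
    {H : Matrix (Fin N) (Fin N) ℂ} (hH : IsComplexHadamard H) (A B : Matrix (Fin N) (Fin N) ℂ)
    (i : Fin 2) {p : FreeAlgebra ℂ (Fin 2)} (hp : p ∈ Algebra.adjoin ℂ {FreeAlgebra.ι ℂ i}) :
    jointLaw (matrixState N P) ![constMatrix P A,
      fakeHaar hW H * constMatrix P B * star (fakeHaar hW H)] p =
    (N : ℂ)⁻¹ * (FreeAlgebra.lift ℂ ![A, B] p).trace := by
  rw [jointLaw_fakeHaar, Finset.sum_congr rfl fun w hw =>
    trace_lift_fakeHaarPair_of_mem_adjoin (mem_signedPermFinset.1 hw) hH A B i hp,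
    Finset.sum_const, nsmul_eq_mul, inv_mul_cancel_left₀ card_signedPermFinset_ne_zero]

end FakeHaar

/-! ### Decay of centred alternating moments. -/

section AsymptoticFreeness

section Norms

open scoped Matrix.Norms.L2Operator

theorem norm_entry_le_l2_opNorm {N : ℕ} (M : Matrix (Fin N) (Fin N) ℂ) (u v : Fin N) :
    ‖M u v‖ ≤ ‖M‖ := by
  refine le_of_sq_le_sq ?_ (norm_nonneg _)
  exact (Finset.single_le_sum (f := fun u => ‖M u v‖ ^ 2) (fun _ _ => by positivity)
    (Finset.mem_univ u)).trans (sum_norm_sq_col_le_l2_opNorm M v)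

theorem norm_normalized_trace_le {N : ℕ} (M : Matrix (Fin N) (Fin N) ℂ) :
    ‖(N : ℂ)⁻¹ * M.trace‖ ≤ ‖M‖ := by
  rcases Nat.eq_zero_or_pos N with rfl | hN
  · simp
  have hN' : (0 : ℝ) < N := Nat.cast_pos.2 hN
  rw [norm_mul, norm_inv, Complex.norm_natCast, inv_mul_le_iff₀ hN']
  refine (norm_sum_le _ _).trans ((Finset.sum_le_card_nsmul _ _ _ fun i _ =>
    norm_entry_le_l2_opNorm M i i).trans_eq ?_)
  simp

theorem norm_one_le_one {N : ℕ} : ‖(1 : Matrix (Fin N) (Fin N) ℂ)‖ ≤ 1 := by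
  rcases Nat.eq_zero_or_pos N with rfl | hN
  · rw [Subsingleton.elim (1 : Matrix (Fin 0) (Fin 0) ℂ) 0]
    simp
  · have : NeZero N := ⟨hN.ne'⟩
    exact CStarRing.norm_one.le

theorem exists_norm_lift_le {A B : ∀ N, Matrix (Fin N) (Fin N) ℂ}
    (hA : ∃ C : ℝ, ∀ N, ‖A N‖ ≤ C) (hB : ∃ C : ℝ, ∀ N, ‖B N‖ ≤ C) (f : FreeAlgebra ℂ (Fin 2)) :
    ∃ M : ℝ, ∀ N, ‖FreeAlgebra.lift ℂ ![A N, B N] f‖ ≤ M := by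
  induction f using FreeAlgebra.induction with
  | grade0 r =>
    refine ⟨‖r‖, fun N => ?_⟩
    rw [AlgHom.commutes, Algebra.algebraMap_eq_smul_one, norm_smul]
    exact mul_le_of_le_one_right (norm_nonneg _) norm_one_le_one
  | grade1 i =>
    simp only [FreeAlgebra.lift_ι_apply]
    fin_cases i
    · exact hA
    · exact hB
  | mul f g hf hg =>
    obtain ⟨a, ha⟩ := hf
    obtain ⟨b, hb⟩ := hg
    refine ⟨a * b, fun N => ?_⟩
    rw [map_mul]
    exact (norm_mul_le _ _).trans
      (mul_le_mul (ha N) (hb N) (norm_nonneg _) ((norm_nonneg _).trans (ha N)))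
  | add f g hf hg =>
    obtain ⟨a, ha⟩ := hf
    obtain ⟨b, hb⟩ := hg
    refine ⟨a + b, fun N => ?_⟩
    rw [map_add]
    exact (norm_add_le _ _).trans (add_le_add (ha N) (hb N))

/-- Power count with `β = N^(-1/2)` and `D = √N M`: `N^(-1) · N^(-(n-1)/2) · N^(n/2) = N^(-1/2)`. -/
theorem exists_norm_average_trace_prod_le (n : ℕ) (hn : 0 < n) (M : ℝ) (hM : 0 ≤ M) :
    ∃ C : ℝ, ∀ (N : ℕ) (H : Matrix (Fin N) (Fin N) ℂ) (i : Fin n → Fin 2)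
      (Z : Fin n → Matrix (Fin N) (Fin N) ℂ), 0 < N → IsComplexHadamard H →
      (List.ofFn i).IsChain (· ≠ ·) → (∀ j, (Z j).trace = 0) → (∀ j, ‖Z j‖ ≤ M) →
      ‖(N : ℂ)⁻¹ * (((signedPermFinset N).card : ℂ)⁻¹ * ∑ w ∈ signedPermFinset N,
        (List.ofFn fun j => hadamardPair H (i j) * (w * Z j * star w) *
          star (hadamardPair H (i j))).prod.trace)‖ ≤ C * (√(N : ℝ))⁻¹ := by
  obtain ⟨C, hC, h⟩ := exists_norm_sum_trace_prod_conj_le (I := Fin 2) n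
  refine ⟨C * M ^ n, fun N H i Z hN hH hi hZ hZM => ?_⟩
  have hN' : (0 : ℝ) < √N := Real.sqrt_pos.2 (Nat.cast_pos.2 hN)
  have key := h N (hadamardPair H) (√(N : ℝ))⁻¹ i Z (√N * M) hn (by positivity) hi
    hH.norm_star_mul_of_ne hH.norm_star_mul_le_one hZ (by positivity) fun a =>
      (sum_norm_sq_le_l2_opNorm (Z a)).trans (by gcongr; exact hZM a)
  have hcard : (0 : ℝ) < (signedPermFinset N).card :=
    Nat.cast_pos.2 (Finset.card_pos.2 ⟨1, one_mem_signedPermFinset⟩)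
  rw [norm_mul, norm_mul, norm_inv, norm_inv, Complex.norm_natCast, Complex.norm_natCast]
  calc _ ≤ (N : ℝ)⁻¹ * (((signedPermFinset N).card : ℝ)⁻¹ * ((signedPermFinset N).card *
        ((√(N : ℝ))⁻¹ ^ (n - 1) * (C * (√N * M) ^ n)))) := by gcongr
    _ = (N : ℝ)⁻¹ * ((√(N : ℝ))⁻¹ ^ (n - 1) * (C * (√N * M) ^ n)) := by
        rw [inv_mul_cancel_left₀ hcard.ne']
    _ = C * M ^ n * (√(N : ℝ))⁻¹ := by
        obtain ⟨n, rfl⟩ := Nat.exists_eq_succ_of_ne_zero hn.ne'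
        have hsq : (N : ℝ)⁻¹ = (√N)⁻¹ * (√N)⁻¹ := by
          rw [← mul_inv, Real.mul_self_sqrt (Nat.cast_nonneg N)]
        rw [Nat.succ_sub_one, mul_pow, inv_pow, pow_succ (√(N : ℝ)), hsq]
        field_simp

theorem tendsto_jointLaw_prod_freeCenter
    {Ω : ℕ → Type*} [∀ N, MeasurableSpace (Ω N)]
    {P : ∀ N, Measure (Ω N)} [∀ N, IsProbabilityMeasure (P N)]
    {W : ∀ N, Ω N → Matrix (Fin N) (Fin N) ℂ} (hW : ∀ N, IsUniformSignedPerm (P N) (W N))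
    {H : ∀ N, Matrix (Fin N) (Fin N) ℂ} (hH : ∀ N, IsComplexHadamard (H N))
    {A B : ∀ N, Matrix (Fin N) (Fin N) ℂ}
    (hA : ∃ C : ℝ, ∀ N, ‖A N‖ ≤ C) (hB : ∃ C : ℝ, ∀ N, ‖B N‖ ≤ C)
    (l : List (Fin 2 × FreeAlgebra ℂ (Fin 2))) (h2 : 2 ≤ l.length)
    (hch : l.IsChain fun x y => x.1 ≠ y.1)
    (hl : ∀ x ∈ l, x.2 ∈ Algebra.adjoin ℂ {FreeAlgebra.ι ℂ x.1}) :
    Tendsto (fun N => jointLaw (matrixState N (P N)) ![constMatrix (P N) (A N),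
      fakeHaar (hW N) (H N) * constMatrix (P N) (B N) * star (fakeHaar (hW N) (H N))]
      (l.map fun x => freeCenter (jointLaw (matrixState N (P N)) ![constMatrix (P N) (A N),
      fakeHaar (hW N) (H N) * constMatrix (P N) (B N) * star (fakeHaar (hW N) (H N))]) x.2).prod)
      atTop (𝓝 0) := by
  set τ : ∀ N, FreeAlgebra ℂ (Fin 2) →ₗ[ℂ] ℂ := fun N => jointLaw (matrixState N (P N))
    ![constMatrix (P N) (A N),
      fakeHaar (hW N) (H N) * constMatrix (P N) (B N) * star (fakeHaar (hW N) (H N))]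
  have hτ' : ∀ N i p, p ∈ Algebra.adjoin ℂ {FreeAlgebra.ι ℂ i} →
      τ N p = (N : ℂ)⁻¹ * (FreeAlgebra.lift ℂ ![A N, B N] p).trace := fun N i p hp =>
    jointLaw_fakeHaar_of_mem_adjoin (hW N) (hH N) (A N) (B N) i hp
  -- One-variable moments do not depend on `W`, so centring under the state is the same as removing
  -- the normalized trace of a deterministic matrix.
  set Z : ∀ N, Fin l.length → Matrix (Fin N) (Fin N) ℂ := fun N j =>
    FreeAlgebra.lift ℂ ![A N, B N] (freeCenter (τ N) (l.get j).2) with hZ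
  have hZ' : ∀ N j, Z N j = FreeAlgebra.lift ℂ ![A N, B N] (l.get j).2 -
      ((N : ℂ)⁻¹ * (FreeAlgebra.lift ℂ ![A N, B N] (l.get j).2).trace) • 1 := by
    intro N j
    simp only [hZ, freeCenter, map_sub]
    rw [hτ' N _ _ (hl _ (List.get_mem l j)), AlgHom.commutes, Algebra.algebraMap_eq_smul_one]
  have hbd : ∃ M : ℝ, 0 ≤ M ∧ ∀ N j, ‖Z N j‖ ≤ M := by
    choose M hM using fun j : Fin l.length => exists_norm_lift_le hA hB (l.get j).2
    have hM0 : ∀ j, 0 ≤ M j := fun j => (norm_nonneg _).trans (hM j 0)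
    refine ⟨∑ j, (M j + M j), Finset.sum_nonneg fun j _ => add_nonneg (hM0 j) (hM0 j),
      fun N j => ?_⟩
    rw [hZ']
    refine ((norm_sub_le _ _).trans (add_le_add (hM j N) ?_)).trans
      (Finset.single_le_sum (f := fun j => M j + M j)
        (fun j _ => add_nonneg (hM0 j) (hM0 j)) (Finset.mem_univ j))
    rw [norm_smul]
    exact (mul_le_of_le_one_right (norm_nonneg _) norm_one_le_one).trans
      ((norm_normalized_trace_le _).trans (hM j N))
  obtain ⟨M, hM0, hM⟩ := hbd
  obtain ⟨C, hC⟩ := exists_norm_average_trace_prod_le l.length (by omega) M hM0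
  have hlim : Tendsto (fun N : ℕ => C * (√(N : ℝ))⁻¹) atTop (𝓝 0) := by
    simpa using
      (Real.tendsto_sqrt_atTop.comp tendsto_natCast_atTop_atTop).inv_tendsto_atTop.const_mul C
  refine squeeze_zero_norm' ?_ hlim
  filter_upwards [eventually_gt_atTop 0] with N hN
  refine le_of_eq_of_le ?_ (hC N (H N) (fun j => (l.get j).1) (Z N) hN (hH N) ?_ ?_ (hM N))
  · have hτN : ∀ f, τ N f = (N : ℂ)⁻¹ * (((signedPermFinset N).card : ℂ)⁻¹ *
        ∑ w ∈ signedPermFinset N,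
          (FreeAlgebra.lift ℂ (fakeHaarPair (H N) (A N) (B N) w) f).trace) :=
      fun f => jointLaw_fakeHaar (hW N) (H N) (A N) (B N) f
    change ‖τ N (l.map fun x => freeCenter (τ N) x.2).prod‖ = _
    rw [hτN]
    congr 3
    refine Finset.sum_congr rfl fun w hw => ?_
    have hw' := mem_signedPermFinset.1 hw
    rw [map_list_prod, List.map_map]
    have : l.map (FreeAlgebra.lift ℂ (fakeHaarPair (H N) (A N) (B N) w) ∘
        fun x => freeCenter (τ N) x.2) =
        l.map fun x => star w * (hadamardPair (H N) x.1 *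
          (w * FreeAlgebra.lift ℂ ![A N, B N] (freeCenter (τ N) x.2) * star w) *
          star (hadamardPair (H N) x.1)) * w :=
      List.map_congr_left fun x hx => lift_fakeHaarPair_of_mem_adjoin hw' (hH N) _ _ _
        (sub_mem (hl x hx) (algebraMap_mem _ _))
    rw [this, list_prod_map_conj hw' l fun x => hadamardPair (H N) x.1 *
          (w * FreeAlgebra.lift ℂ ![A N, B N] (freeCenter (τ N) x.2) * star w) *
          star (hadamardPair (H N) x.1), Matrix.trace_mul_comm, ← mul_assoc,
      signedPermMatrices_mul_star_self hw', one_mul]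
    congr 2
    refine List.ext_getElem (by simp) fun k h1 h2 => ?_
    simp [hZ]
  · rw [List.isChain_ofFn]
    exact fun k hk => List.isChain_iff_getElem.1 hch k hk
  · intro j
    rw [hZ', Matrix.trace_sub, Matrix.trace_smul, Matrix.trace_one, Fintype.card_fin, smul_eq_mul]
    have : (N : ℂ) ≠ 0 := Nat.cast_ne_zero.2 hN.ne'
    field_simp
    ring

end Norms

end AsymptoticFreeness

/-! ### Free convolutions and the main theorem. -/

section Conclusion

theorem isFreeAddConv_freeAddConv {μ ν ρ : Measure ℝ} (h : IsFreeAddConv μ ν ρ) :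
    IsFreeAddConv μ ν (freeAddConv μ ν) := by
  have hex : ∃ ρ, IsFreeAddConv μ ν ρ := ⟨ρ, h⟩
  rw [freeAddConv, dif_pos hex]
  exact hex.choose_spec

theorem isFreeMulConv_freeMulConv {μ ν ρ : Measure ℝ} (h : IsFreeMulConv μ ν ρ) :
    IsFreeMulConv μ ν (freeMulConv μ ν) := by
  have hex : ∃ ρ, IsFreeMulConv μ ν ρ := ⟨ρ, h⟩
  rw [freeMulConv, dif_pos hex]
  exact hex.choose_spec

theorem trace_mul_pow_comm {n : Type*} [Fintype n] [DecidableEq n] (X Y : Matrix n n ℂ) (k : ℕ) :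
    ((X * Y) ^ k).trace = ((Y * X) ^ k).trace := by
  cases k with
  | zero => simp
  | succ k =>
    have : ∀ k, (X * Y) ^ (k + 1) = X * (Y * X) ^ k * Y := by
      intro k
      induction k with
      | zero => simp
      | succ k ih => rw [pow_succ, ih, pow_succ (Y * X)]; simp only [mul_assoc]
    rw [this, Matrix.trace_mul_comm, ← mul_assoc, ← pow_succ']

theorem sqrt_mul_sqrt_of_posSemidef {n : Type*} [Fintype n] [DecidableEq n] {X : Matrix n n ℂ}
    (hX : X.PosSemidef) : CFC.sqrt X * CFC.sqrt X = X :=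
  CFC.sqrt_mul_sqrt_self X hX.nonneg

theorem isHermitian_sqrt {n : Type*} [Fintype n] [DecidableEq n] (X : Matrix n n ℂ) :
    (CFC.sqrt X).IsHermitian :=
  (Matrix.nonneg_iff_posSemidef.1 (CFC.sqrt_nonneg X)).isHermitian

section PairNorm

open scoped Matrix.Norms.L2Operator

variable {N : ℕ} {H A B w : Matrix (Fin N) (Fin N) ℂ}

theorem norm_fakeHaarPair_one_le (hw : w ∈ signedPermMatrices N) (hH : IsComplexHadamard H) :
    ‖fakeHaarPair H A B w 1‖ ≤ ‖B‖ := by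
  have hU := fakeHaarMatrix_mem_unitary hw hH
  change ‖fakeHaarMatrix H w * B * star (fakeHaarMatrix H w)‖ ≤ ‖B‖
  rw [CStarRing.norm_mul_mem_unitary _ (Unitary.star_mem hU), CStarRing.norm_mem_unitary_mul _ hU]

/-- By the C*-identity `‖S‖² = ‖S * S‖`; for `S = √A` the bound is thus in terms of `‖A‖`. -/
theorem norm_mul_mul_self_le {S : Matrix (Fin N) (Fin N) ℂ} (hS : S.IsHermitian)
    (Y : Matrix (Fin N) (Fin N) ℂ) : ‖S * Y * S‖ ≤ ‖S * S‖ * ‖Y‖ := by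
  have h : ‖S‖ * ‖S‖ = ‖S * S‖ := by
    rw [← CStarRing.norm_star_mul_self, Matrix.star_eq_conjTranspose, hS.eq]
  calc _ ≤ ‖S‖ * ‖Y‖ * ‖S‖ :=
        (norm_mul_le _ _).trans (mul_le_mul_of_nonneg_right (norm_mul_le _ _) (norm_nonneg _))
    _ = ‖S * S‖ * ‖Y‖ := by rw [← h]; ring

end PairNorm

theorem isHermitian_fakeHaarPair_one {N : ℕ} {H A B w : Matrix (Fin N) (Fin N) ℂ}
    (hB : B.IsHermitian) : (fakeHaarPair H A B w 1).IsHermitian := by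
  change (fakeHaarMatrix H w * B * star (fakeHaarMatrix H w)).IsHermitian
  exact Matrix.isHermitian_mul_mul_conjTranspose _ hB

section LimitLaws

open scoped Matrix.Norms.L2Operator in
theorem exists_isBoundedLaw_fakeHaarPair_add
    {H A B : ∀ N, Matrix (Fin N) (Fin N) ℂ} (hH : ∀ N, IsComplexHadamard (H N))
    (hB : ∀ N, (B N).IsHermitian)
    (hAbdd : ∃ C : ℝ, ∀ N, ‖Matrix.toEuclideanCLM (𝕜 := ℂ) (A N)‖ ≤ C)
    (hBbdd : ∃ C : ℝ, ∀ N, ‖Matrix.toEuclideanCLM (𝕜 := ℂ) (B N)‖ ≤ C)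
    (hA : ∀ N, (A N).IsHermitian) (m : ℕ → ℂ)
    (hm : ∀ k, Tendsto (fun N : ℕ => (N : ℂ)⁻¹ * (((signedPermFinset N).card : ℂ)⁻¹ *
      ∑ w ∈ signedPermFinset N, ((fakeHaarPair (H N) (A N) (B N) w 0 +
        fakeHaarPair (H N) (A N) (B N) w 1) ^ k).trace)) atTop (𝓝 (m k))) :
    ∃ ρ : Measure ℝ, IsBoundedLaw ρ ∧ ∀ k, m k = ((∫ x, x ^ k ∂ρ : ℝ) : ℂ) := by
  -- The scoped matrix norm unfolds to the norm of `Matrix.toEuclideanCLM`.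
  obtain ⟨CA, hCA⟩ : ∃ C : ℝ, ∀ N, ‖A N‖ ≤ C := hAbdd
  obtain ⟨CB, hCB⟩ : ∃ C : ℝ, ∀ N, ‖B N‖ ≤ C := hBbdd
  exact exists_isBoundedLaw_of_tendsto signedPermFinset
    (fun N => ⟨1, one_mem_signedPermFinset⟩) _ (CA + CB)
    (add_nonneg ((norm_nonneg _).trans (hCA 0)) ((norm_nonneg _).trans (hCB 0)))
    (fun N w _ => (hA N).add (isHermitian_fakeHaarPair_one (hB N)))
    (fun N w hw => (norm_add_le _ _).trans (add_le_add (hCA N)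
      ((norm_fakeHaarPair_one_le (mem_signedPermFinset.1 hw) (hH N)).trans (hCB N)))) m hm

open scoped Matrix.Norms.L2Operator in
theorem exists_isBoundedLaw_fakeHaarPair_mul
    {H A B : ∀ N, Matrix (Fin N) (Fin N) ℂ} (hH : ∀ N, IsComplexHadamard (H N))
    (hB : ∀ N, (B N).IsHermitian)
    (hAbdd : ∃ C : ℝ, ∀ N, ‖Matrix.toEuclideanCLM (𝕜 := ℂ) (A N)‖ ≤ C)
    (hBbdd : ∃ C : ℝ, ∀ N, ‖Matrix.toEuclideanCLM (𝕜 := ℂ) (B N)‖ ≤ C)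
    {S : ∀ N, Matrix (Fin N) (Fin N) ℂ}
    (hS : ∀ N, (S N).IsHermitian) (hSA : ∀ N, S N * S N = A N) (m : ℕ → ℂ)
    (hm : ∀ k, Tendsto (fun N : ℕ => (N : ℂ)⁻¹ * (((signedPermFinset N).card : ℂ)⁻¹ *
      ∑ w ∈ signedPermFinset N,
        ((S N * fakeHaarPair (H N) (A N) (B N) w 1 * S N) ^ k).trace)) atTop (𝓝 (m k))) :
    ∃ ρ : Measure ℝ, IsBoundedLaw ρ ∧ ∀ k, m k = ((∫ x, x ^ k ∂ρ : ℝ) : ℂ) := by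
  obtain ⟨CA, hCA⟩ : ∃ C : ℝ, ∀ N, ‖A N‖ ≤ C := hAbdd
  obtain ⟨CB, hCB⟩ : ∃ C : ℝ, ∀ N, ‖B N‖ ≤ C := hBbdd
  have hCA0 : 0 ≤ CA := (norm_nonneg _).trans (hCA 0)
  refine exists_isBoundedLaw_of_tendsto signedPermFinset
    (fun N => ⟨1, one_mem_signedPermFinset⟩) _ (CA * CB)
    (mul_nonneg hCA0 ((norm_nonneg _).trans (hCB 0)))
    (fun N w _ => ?_) (fun N w hw => ?_) m hm
  · have := Matrix.isHermitian_mul_mul_conjTranspose (S N)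
      (isHermitian_fakeHaarPair_one (H := H N) (A := A N) (w := w) (hB N))
    rwa [(hS N).eq] at this
  · refine (norm_mul_mul_self_le (hS N) _).trans ?_
    rw [hSA]
    exact mul_le_mul (hCA N)
      ((norm_fakeHaarPair_one_le (mem_signedPermFinset.1 hw) (hH N)).trans (hCB N))
      (norm_nonneg _) hCA0

end LimitLaws

theorem corollary3p2
    {Ω : ℕ → Type*} [∀ N, MeasurableSpace (Ω N)]
    (P : ∀ N, Measure (Ω N)) [∀ N, IsProbabilityMeasure (P N)]
    (W : ∀ N, Ω N → Matrix (Fin N) (Fin N) ℂ) (hW : ∀ N, IsUniformSignedPerm (P N) (W N))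
    (H : ∀ N, Matrix (Fin N) (Fin N) ℂ) (hH : ∀ N, IsComplexHadamard (H N))
    (A B : ∀ N, Matrix (Fin N) (Fin N) ℂ)
    (hA : ∀ N, (A N).IsHermitian) (hB : ∀ N, (B N).IsHermitian)
    (hAbdd : ∃ C : ℝ, ∀ N, ‖Matrix.toEuclideanCLM (𝕜 := ℂ) (A N)‖ ≤ C)
    (hBbdd : ∃ C : ℝ, ∀ N, ‖Matrix.toEuclideanCLM (𝕜 := ℂ) (B N)‖ ≤ C)
    (μA μB : Measure ℝ) (hμA : IsBoundedLaw μA) (hμB : IsBoundedLaw μB)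
    (hAlim : ∀ k : ℕ, 0 < k → Tendsto (fun N : ℕ => (N : ℂ)⁻¹ * (A N ^ k).trace) atTop
      (𝓝 ((∫ x, x ^ k ∂μA : ℝ) : ℂ)))
    (hBlim : ∀ k : ℕ, 0 < k → Tendsto (fun N : ℕ => (N : ℂ)⁻¹ * (B N ^ k).trace) atTop
      (𝓝 ((∫ x, x ^ k ∂μB : ℝ) : ℂ))) :
    AsymptoticallyFree (fun N => matrixState N (P N))
      (fun N => ![constMatrix (P N) (A N),
        fakeHaar (hW N) (H N) * constMatrix (P N) (B N) * star (fakeHaar (hW N) (H N))]) ∧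
    (IsFreeAddConv μA μB (freeAddConv μA μB) ∧
      ConvergesInMoments (fun N => matrixState N (P N))
        (fun N => constMatrix (P N) (A N) +
          fakeHaar (hW N) (H N) * constMatrix (P N) (B N) * star (fakeHaar (hW N) (H N)))
        (freeAddConv μA μB)) ∧
    ((∀ N, (A N).PosSemidef) →
      IsFreeMulConv μA μB (freeMulConv μA μB) ∧
      ConvergesInMoments (fun N => matrixState N (P N))
        (fun N => constMatrix (P N) (CFC.sqrt (A N)) *
          (fakeHaar (hW N) (H N) * constMatrix (P N) (B N) * star (fakeHaar (hW N) (H N))) *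
          constMatrix (P N) (CFC.sqrt (A N)))
        (freeMulConv μA μB)) := by
  have hPA := hμA.isProbabilityMeasure
  have hPB := hμB.isProbabilityMeasure
  set τ : ∀ N, FreeAlgebra ℂ (Fin 2) →ₗ[ℂ] ℂ := fun N => jointLaw (matrixState N (P N))
    ![constMatrix (P N) (A N),
      fakeHaar (hW N) (H N) * constMatrix (P N) (B N) * star (fakeHaar (hW N) (H N))]
  have hτ : ∀ N f, τ N f = (N : ℂ)⁻¹ * (((signedPermFinset N).card : ℂ)⁻¹ *
      ∑ w ∈ signedPermFinset N, (FreeAlgebra.lift ℂ (fakeHaarPair (H N) (A N) (B N) w) f).trace) :=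
    fun N f => jointLaw_fakeHaar (hW N) (H N) (A N) (B N) f
  have hpow : ∀ N i k, τ N (FreeAlgebra.ι ℂ i ^ k) =
      (N : ℂ)⁻¹ * ((![A N, B N] i) ^ k).trace := by
    intro N i k
    refine (jointLaw_fakeHaar_of_mem_adjoin (hW N) (hH N) (A N) (B N) i
      (pow_mem (Algebra.self_mem_adjoin_singleton ℂ (FreeAlgebra.ι ℂ i)) k)).trans ?_
    rw [map_pow (FreeAlgebra.lift ℂ ![A N, B N]), FreeAlgebra.lift_ι_apply]
  -- At `N = 0` the state of `1` is `0`, so normalization holds only eventually.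
  have hzero : ∀ i, Tendsto (fun N => τ N (FreeAlgebra.ι ℂ i ^ 0)) atTop (𝓝 1) := by
    intro i
    refine tendsto_const_nhds.congr' ?_
    filter_upwards [eventually_ne_atTop 0] with N hN
    rw [hpow, pow_zero, Matrix.trace_one, Fintype.card_fin, inv_mul_cancel₀]
    exact Nat.cast_ne_zero.2 hN
  have hleft : ∀ k : ℕ, Tendsto (fun N => τ N (FreeAlgebra.ι ℂ 0 ^ k)) atTop
      (𝓝 ((∫ x, x ^ k ∂μA : ℝ) : ℂ)) := by
    intro k
    rcases Nat.eq_zero_or_pos k with rfl | hk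
    · simpa using hzero 0
    · simpa only [hpow, Matrix.cons_val_zero] using hAlim k hk
  have hright : ∀ k : ℕ, Tendsto (fun N => τ N (FreeAlgebra.ι ℂ 1 ^ k)) atTop
      (𝓝 ((∫ x, x ^ k ∂μB : ℝ) : ℂ)) := by
    intro k
    rcases Nat.eq_zero_or_pos k with rfl | hk
    · simpa using hzero 1
    · simpa only [hpow, Matrix.cons_val_one, Matrix.cons_val_fin_one] using hBlim k hk
  have hone : Tendsto (fun N => τ N 1) atTop (𝓝 1) := by simpa using hzero 0
  obtain ⟨σ, hσ, hfree⟩ := exists_free_limit hone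
    (fun i k => by
      fin_cases i
      · exact ⟨_, hleft k⟩
      · exact ⟨_, hright k⟩)
    fun l h2 hch hl => tendsto_jointLaw_prod_freeCenter hW hH hAbdd hBbdd l h2 hch hl
  have hpair : IsFreePairLaw μA μB σ :=
    ⟨tendsto_nhds_unique (hσ 1) hone, hfree, fun k => tendsto_nhds_unique (hσ _) (hleft k),
      fun k => tendsto_nhds_unique (hσ _) (hright k)⟩
  refine ⟨⟨σ, hσ, hfree⟩, ?_, fun hpos => ?_⟩
  · have htrace : ∀ N k w, ((fakeHaarPair (H N) (A N) (B N) w 0 +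
        fakeHaarPair (H N) (A N) (B N) w 1) ^ k).trace =
        ((FreeAlgebra.lift ℂ (fakeHaarPair (H N) (A N) (B N) w))
          ((FreeAlgebra.ι ℂ 0 + FreeAlgebra.ι ℂ 1) ^ k)).trace := by
      intro N k w
      rw [map_pow, map_add, FreeAlgebra.lift_ι_apply, FreeAlgebra.lift_ι_apply]
    obtain ⟨ρ, hρ, hmom⟩ := exists_isBoundedLaw_fakeHaarPair_add hH hB hAbdd hBbdd hA
      (fun k => σ ((FreeAlgebra.ι ℂ 0 + FreeAlgebra.ι ℂ 1) ^ k))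
      (fun k => by
        simpa only [hτ, htrace] using hσ ((FreeAlgebra.ι ℂ 0 + FreeAlgebra.ι ℂ 1) ^ k))
    have hconv := isFreeAddConv_freeAddConv ⟨hρ, σ, hpair, hmom⟩
    refine ⟨hconv, fun k => ?_⟩
    -- The chosen convolution comes with its own free pair law, which uniqueness identifies with
    -- `σ`.
    obtain ⟨σ', hσ', hmom'⟩ := hconv.moments
    rw [← hmom', hσ'.unique hpair]
    refine (hσ _).congr fun N => ?_
    rw [hτ, (hW N).matrixState_eq _ (fun w => (fakeHaarPair (H N) (A N) (B N) w 0 +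
      fakeHaarPair (H N) (A N) (B N) w 1) ^ k) fun ω => rfl]
    simp only [htrace]
  -- Cyclicity of the trace moves one square root around, turning moments of `√A Y √A` into those of
  -- `A Y`.
  · have htrace : ∀ N k w, ((CFC.sqrt (A N) * fakeHaarPair (H N) (A N) (B N) w 1 *
        CFC.sqrt (A N)) ^ k).trace = ((FreeAlgebra.lift ℂ (fakeHaarPair (H N) (A N) (B N) w))
          ((FreeAlgebra.ι ℂ 0 * FreeAlgebra.ι ℂ 1) ^ k)).trace := by
      intro N k w
      rw [trace_mul_pow_comm, ← mul_assoc, sqrt_mul_sqrt_of_posSemidef (hpos N), map_pow, map_mul,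
        FreeAlgebra.lift_ι_apply, FreeAlgebra.lift_ι_apply]
      rfl
    obtain ⟨ρ, hρ, hmom⟩ := exists_isBoundedLaw_fakeHaarPair_mul hH hB hAbdd hBbdd
      (fun N => isHermitian_sqrt (A N)) (fun N => sqrt_mul_sqrt_of_posSemidef (hpos N))
      (fun k => σ ((FreeAlgebra.ι ℂ 0 * FreeAlgebra.ι ℂ 1) ^ k))
      (fun k => by
        simpa only [hτ, htrace] using hσ ((FreeAlgebra.ι ℂ 0 * FreeAlgebra.ι ℂ 1) ^ k))
    have hconv := isFreeMulConv_freeMulConv ⟨hρ, σ, hpair, hmom⟩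
    refine ⟨hconv, fun k => ?_⟩
    obtain ⟨σ', hσ', hmom'⟩ := hconv.moments
    rw [← hmom', hσ'.unique hpair]
    refine (hσ _).congr fun N => ?_
    rw [hτ, (hW N).matrixState_eq _ (fun w => (CFC.sqrt (A N) *
      fakeHaarPair (H N) (A N) (B N) w 1 * CFC.sqrt (A N)) ^ k) fun ω => rfl]
    simp only [htrace]

end Conclusion
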